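/- Let $\Bbbk$ be an algebraically closed field, $n$ a positive integer, and let $\mathcal{C}_n$ be the Catalan monoid of all maps $f:\{1,\dots,n\}\to\{1,\dots,n\}$ with $f(i)\le i$ for all $i$ and $f(i)\le f(j)$ whenever $i\le j$, under composition of maps ($fg=f\circ g$). For $1\le i\le n-1$ let $\alpha_i\in\mathcal{C}_n$ send $i+1$ to $i$ and fix all other points, and let $\mathbf{0}\in\mathcal{C}_n$ be the constant map with value $1$, which is the zero element of $\mathcal{C}_n$. Let $\mathbf{Q}$ be the quiver $1\to 2\to\cdots\to n-1$, let $A$ be its $\Bbbk$-linear path category, and let $\mathcal{X}$ be an abelian category with a fixed equivalence to the category of finite dimensional left $A$-modules (covariant representations of $\mathbf{Q}$). Let $L_i$ be the simple module at the vertex $i$, let $I_i$ be its injective envelope, let $I=A(-,-)^*$ be the dual of the regular $A$-$A$-bimodule ($*$ denotes the $\Bbbk$-dual), let $\mathrm{F}_i=\mathrm{Id}/\mathrm{Tr}_{L_i}$, where $\mathrm{Tr}_{L_i}(N)$ is the sum of the images of all homomorphisms $L_i\to N$, and let $\mathrm{G}_i=\mathrm{Hom}_A((\mathrm{F}_iI)^*,-)$,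 transported to an endofunctor of $\mathcal{X}$. Let $\mathscr{G}_n$ be the $2$-category with the single object $\mathcal{X}$, whose $1$-morphisms are the endofunctors of $\mathcal{X}$ isomorphic to finite direct sums of direct summands of compositions of the functors $\mathrm{G}_i$ (including the empty composition $\mathrm{Id}$), and whose $2$-morphisms are all natural transformations. Let $\mathcal{S}[\mathscr{G}_n]$ be the set of isomorphism classes of those $1$-morphisms that are indecomposable or zero. (a) $\mathcal{S}[\mathscr{G}_n]$ contains the class of $\mathrm{Id}$ and is closed under composition of $1$-morphisms; composition makes it a semigroup (indeed a monoid). (b) There is an isomorphism of monoids $\Phi:\mathcal{C}_n\to\mathcal{S}[\mathscr{G}_n]$ with $\Phi(\alpha_i)=[\mathrm{G}_i]$ for all $i$; the only element sent to the class of the zero functor is $\mathbf{0}$. (c) Let $\mathrm{Gr}(\mathscr{G}_n)$ be the Grothendieck ring of $\mathscr{G}_n$, that is, the split Grothendieck group of its category of $1$-morphisms with the multiplication induced by composition. Sending the class of a $1$-morphism in $\Phi(f)$ to the class of $f$, for $f\in\mathcal{C}_n$, gives a ring isomorphism from $\mathrm{Gr}(\mathscr{G}_n)$ to the contracted integral monoid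 ring $\mathbb{Z}[\mathcal{C}_n]/\mathbb{Z}\mathbf{0}$, in which the zero element of $\mathcal{C}_n$ is identified with $0$. (d) $[\mathrm{F}]\cdot[M]=[\mathrm{F}M]$ defines an action of $\mathrm{Gr}(\mathscr{G}_n)$ on the Grothendieck group $\mathrm{Gr}(\mathcal{X})$ of the abelian category $\mathcal{X}$. The classes $[I_1],\dots,[I_{n-1}]$ form a $\mathbb{Z}$-basis of $\mathrm{Gr}(\mathcal{X})$, and through $\Phi$ each $f\in\mathcal{C}_n$ acts by $[I_j]\mapsto[I_{f(j+1)-1}]$, where $[I_0]:=0$. This is the natural representation of $\mathcal{C}_n$; in particular $\alpha_i$ sends $[I_i]$ to $[I_{i-1}]$ and fixes all other $[I_j]$. -/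

import Mathlib

open CategoryTheory CategoryTheory.Limits Opposite

universe u v w

set_option linter.unusedSectionVars false

noncomputable section

namespace CatalanCat

/-! ### The Catalan monoid and its natural integral representation -/

/-- Order-preserving and order-decreasing self-maps of an `N`-element chain,
with multiplication `f * g = f ∘ g`. -/
def catalan (N : ℕ) : Submonoid (Function.End (Fin N)) where
  carrier := {f | Monotone f ∧ ∀ i, f i ≤ i}
  one_mem' := ⟨monotone_id, fun _ => le_rfl⟩
  mul_mem' := fun hf hg => ⟨hf.1.comp hg.1, fun i => (hf.2 _).trans (hg.2 i)⟩

/-- The generator sending the point `i + 1` to `i` and fixing all other points. -/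
def alpha {m : ℕ} (i : Fin m) : catalan (m + 1) :=
  ⟨fun j => if j = i.succ then i.castSucc else j, by
    constructor
    · intro a b hab
      simp only [Fin.le_def, Fin.ext_iff] at *
      split_ifs <;> simp_all <;> omega
    · intro a
      simp only [Fin.le_def, Fin.ext_iff]
      split_ifs <;> simp_all⟩

/-- The zero element of the Catalan monoid: the constant map onto the least point. -/
def catalanZero (m : ℕ) : catalan (m + 1) :=
  ⟨fun _ => 0, fun _ _ _ => le_rfl, fun i => Fin.zero_le i⟩

/-- The natural representation on `ℤ ^ m`. The basis vector `e_c` stands for the point `c + 1` of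
the chain `0 < 1 < ⋯ < m`; the map `f` sends `e_c` to `e_r` if `f (c + 1) = r + 1`, and to zero if
`f (c + 1) = 0`. -/
def naturalRep (m : ℕ) : catalan (m + 1) →* Matrix (Fin m) (Fin m) ℤ where
  toFun f := Matrix.of fun r c => if f.1 c.succ = r.succ then 1 else 0
  map_one' := by
    ext r c
    change (if c.succ = r.succ then (1 : ℤ) else 0) = _
    simp [Matrix.one_apply, eq_comm]
  map_mul' f g := by
    ext r c
    have h0 : f.1 0 = 0 := Fin.le_zero_iff.1 (f.2.2 0)
    simp only [Matrix.mul_apply, Matrix.of_apply, mul_ite, mul_one, mul_zero]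
    change (if f.1 (g.1 c.succ) = r.succ then (1 : ℤ) else 0) = _
    rcases Fin.eq_zero_or_eq_succ (g.1 c.succ) with h | ⟨s, h⟩
    · rw [h, h0, if_neg (Fin.succ_ne_zero r).symm]
      refine (Finset.sum_eq_zero fun s _ => ?_).symm
      rw [if_neg (Fin.succ_ne_zero s).symm]
    · rw [h, Finset.sum_eq_single s]
      · simp
      · intro t _ hts
        rw [if_neg]
        intro hh
        exact hts (Fin.succ_injective _ hh).symm
      · simp

/-- On generators: `e_i` is sent to the sum of the `e_j` over the arrows `j → i` of the linear
quiver, that is to `e_{i-1}`, or to zero for the least `i`; all other `e_c` are fixed. -/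
theorem naturalRep_alpha {m : ℕ} (i r c : Fin m) :
    naturalRep m (alpha i) r c =
      if c = i then (if r.val + 1 = i.val then 1 else 0) else (if r = c then 1 else 0) := by
  simp only [naturalRep, alpha, MonoidHom.coe_mk, OneHom.coe_mk, Matrix.of_apply]
  rcases eq_or_ne c i with rfl | h
  · simp [Fin.ext_iff, eq_comm]
  · simp [h, eq_comm (a := r), (Fin.succ_injective m).eq_iff]

/-! ### Modules and bimodules over the path category of a quiver -/

/-- The linear quiver with vertices `0, …, m - 1` and one arrow `i ⟶ i + 1` for each `i`. -/
def LinearQuiver (m : ℕ) : Type := Fin m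

instance (m : ℕ) : Finite (LinearQuiver m) := inferInstanceAs (Finite (Fin m))

instance (m : ℕ) : Quiver (LinearQuiver m) where
  Hom i j := PLift (Fin.val i + 1 = Fin.val j)

theorem LinearQuiver.le_of_path {m : ℕ} {i j : LinearQuiver m} (p : Quiver.Path i j) :
    Fin.val i ≤ Fin.val j := by
  induction p with
  | nil => exact le_rfl
  | cons _ e ih =>
    have h := e.down
    omega

theorem LinearQuiver.path_eq {m : ℕ} {i j : LinearQuiver m} (p q : Quiver.Path i j) : p = q := by
  induction p with
  | nil =>
    cases q with
    | nil => rfl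
    | cons q' e =>
      have h := e.down
      have h' := LinearQuiver.le_of_path q'
      omega
  | cons p' e ih =>
    cases q with
    | nil =>
      have h := e.down
      have h' := LinearQuiver.le_of_path p'
      omega
    | cons q' e' =>
      have h := e.down
      have h' := e'.down
      obtain rfl := Fin.ext (Nat.succ_injective (h.trans h'.symm))
      rw [ih q', Subsingleton.elim (α := PLift _) e e']

instance {m : ℕ} (i j : LinearQuiver m) : Finite (Quiver.Path i j) :=
  have : Subsingleton (Quiver.Path i j) := ⟨LinearQuiver.path_eq⟩
  inferInstance

section Modules

variable (k : Type u) [Field k] (V : Type) [Quiver.{0} V]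

/-- Left modules over the `k`-linear path category, that is, representations of the quiver. -/
abbrev LMod := Paths V ⥤ ModuleCat.{u} k

/-- Bimodules over the `k`-linear path category: `B.obj (op a)` is a left module, which is
contravariant in `a` (the right module structure). -/
abbrev BiMod := (Paths V)ᵒᵖ ⥤ LMod k V

/-- The regular bimodule `P`: its value at `(op a, b)` is the space of formal linear combinations
of paths from `a` to `b`; so `P.obj (op a)` is the indecomposable projective at `a`. -/
def regular : BiMod k V where
  obj a :=
    { obj b := ModuleCat.of k ((a.unop ⟶ b) →₀ k)
      map f := ModuleCat.ofHom (Finsupp.lmapDomain k k (fun p => p ≫ f))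
      map_id b := by
        ext : 1
        simp only [Category.comp_id]
        exact Finsupp.lmapDomain_id k k
      map_comp f g := by
        ext : 1
        simp only [← Category.assoc]
        exact Finsupp.lmapDomain_comp k k (fun p => p ≫ f) (fun p => p ≫ g) }
  map h :=
    { app b := ModuleCat.ofHom (Finsupp.lmapDomain k k (fun p => h.unop ≫ p))
      naturality b b' f := by
        ext : 1
        change (Finsupp.lmapDomain k k _) ∘ₗ (Finsupp.lmapDomain k k _) =
          (Finsupp.lmapDomain k k _) ∘ₗ (Finsupp.lmapDomain k k _)
        rw [← Finsupp.lmapDomain_comp, ← Finsupp.lmapDomain_comp]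
        congr 1
        funext p
        simp }
  map_id a := by
    ext b : 3
    simp only [unop_id, Category.id_comp]
    exact Finsupp.lmapDomain_id k k
  map_comp h h' := by
    ext b : 3
    simp only [unop_comp, Category.assoc]
    exact Finsupp.lmapDomain_comp k k (fun p => h.unop ≫ p) (fun p => h'.unop ≫ p)

variable {k V}

/-- The dual bimodule `B^*`, with value `Hom_k(B(op a, b), k)` at `(op b, a)`. -/
def dualBimod (B : BiMod k V) : BiMod k V where
  obj b :=
    { obj a := ModuleCat.of k (Module.Dual k ((B.obj (op a)).obj b.unop))
      map f := ModuleCat.ofHom (LinearMap.dualMap ((B.map f.op).app b.unop).hom)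
      map_id a := by
        ext : 1
        simp only [op_id, CategoryTheory.Functor.map_id, NatTrans.id_app]
        exact LinearMap.dualMap_id
      map_comp f g := by
        ext : 1
        simp only [op_comp, CategoryTheory.Functor.map_comp, NatTrans.comp_app]
        rfl }
  map h :=
    { app a := ModuleCat.ofHom (LinearMap.dualMap ((B.obj (op a)).map h.unop).hom)
      naturality a a' f := by
        ext : 1
        change (LinearMap.dualMap _) ∘ₗ (LinearMap.dualMap _) =
          (LinearMap.dualMap _) ∘ₗ (LinearMap.dualMap _)
        rw [LinearMap.dualMap_comp_dualMap, LinearMap.dualMap_comp_dualMap]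
        exact congrArg (fun g => LinearMap.dualMap g.hom) ((B.map f.op).naturality h.unop) }
  map_id b := by
    ext a : 3
    simp only [unop_id, CategoryTheory.Functor.map_id]
    exact LinearMap.dualMap_id
  map_comp h h' := by
    ext a : 3
    simp only [unop_comp, CategoryTheory.Functor.map_comp]
    rfl

variable (k V) in
/-- The bimodule `I = P^*`; the left module `I.obj (op i)` is the indecomposable injective at `i`,
with value `Hom_k(A(b, i), k)` at `b`. -/
def injBimod : BiMod k V := dualBimod (regular k V)

variable (k) in
/-- The action of a path on the simple module at `i`: the value of this module at `j` is `k` if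
`i = j` and zero otherwise, realised as the functions to `k` from the type of proofs of `i = j`;
paths of positive length act by zero. -/
def simpleMap (i : V) {j j' : V} (p : Quiver.Path j j') :
    (PLift (i = j) → k) →ₗ[k] (PLift (i = j') → k) where
  toFun φ h := if hp : p.length = 0 then
    φ ⟨h.down.trans (Quiver.Path.eq_of_length_zero p hp).symm⟩ else 0
  map_add' φ ψ := by
    funext h
    simp only [Pi.add_apply]
    split_ifs <;> simp
  map_smul' c φ := by
    funext h
    simp only [Pi.smul_apply, RingHom.id_apply]
    split_ifs <;> simp

theorem simpleMap_nil (i j : V) :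
    simpleMap k i (Quiver.Path.nil : Quiver.Path j j) = LinearMap.id := by
  refine LinearMap.ext fun φ => funext fun h => ?_
  simp [simpleMap]

theorem simpleMap_comp (i : V) {j j' j'' : V} (p : Quiver.Path j j') (q : Quiver.Path j' j'') :
    simpleMap k i (p.comp q) = simpleMap k i q ∘ₗ simpleMap k i p := by
  refine LinearMap.ext fun φ => funext fun h => ?_
  by_cases hq : q.length = 0 <;> by_cases hp : p.length = 0 <;> simp [simpleMap, hp, hq]

variable (k) in
/-- The simple module `L_i` at the vertex `i`. -/
def simpleMod (i : V) : LMod k V where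
  obj j := ModuleCat.of k (PLift (@Eq V i j) → k)
  map {j j'} p := ModuleCat.ofHom (simpleMap (V := V) (j := j) (j' := j') k i p)
  map_id j := ModuleCat.hom_ext (simpleMap_nil (V := V) i j)
  map_comp {j j' j''} p q :=
    ModuleCat.hom_ext (simpleMap_comp (V := V) (j := j) (j' := j') (j'' := j'') i p q)

/-- The trace of `L` in `N`, the sum of the images of all homomorphisms `L ⟶ N`, at a vertex. -/
def trace (L N : LMod k V) (b : Paths V) : Submodule k (N.obj b) :=
  ⨆ f : L ⟶ N, LinearMap.range (f.app b).hom

theorem trace_le_map (L N : LMod k V) {b b' : Paths V} (p : b ⟶ b') :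
    trace L N b ≤ (trace L N b').comap (N.map p).hom := by
  refine iSup_le fun f => ?_
  rintro _ ⟨x, rfl⟩
  have h : (N.map p).hom ((f.app b).hom x) = (f.app b').hom ((L.map p).hom x) :=
    (congrArg (fun g => g.hom x) (f.naturality p)).symm
  rw [Submodule.mem_comap, h]
  exact Submodule.mem_iSup_of_mem f ⟨_, rfl⟩

theorem trace_le_app (L : LMod k V) {N N' : LMod k V} (g : N ⟶ N') (b : Paths V) :
    trace L N b ≤ (trace L N' b).comap (g.app b).hom := by
  refine iSup_le fun f => ?_
  rintro _ ⟨x, rfl⟩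
  exact Submodule.mem_iSup_of_mem (f ≫ g) ⟨x, rfl⟩

/-- The functor `Id / Tr_L`. -/
def quotTrace (L : LMod k V) : LMod k V ⥤ LMod k V where
  obj N :=
    { obj b := ModuleCat.of k (N.obj b ⧸ trace L N b)
      map p := ModuleCat.ofHom (Submodule.mapQ _ _ (N.map p).hom (trace_le_map L N p))
      map_id b := by
        ext x
        simp
      map_comp p q := by
        ext x
        simp }
  map g :=
    { app b := ModuleCat.ofHom (Submodule.mapQ _ _ (g.app b).hom (trace_le_app L g b))
      naturality b b' p := by
        ext : 1
        refine Submodule.linearMap_qext _ (LinearMap.ext fun x => ?_)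
        exact congrArg (fun h => (trace L _ b').mkQ (h.hom x)) (g.naturality p) }
  map_id N := by
    ext b x
    simp
  map_comp f g := by
    ext b x
    simp

/-- The projection functor `F_i = Id / Tr_{L_i}`. -/
def projFunctor (i : V) : LMod k V ⥤ LMod k V := quotTrace (simpleMod k i)

/-- The functor `Hom_A(B, -)` of a bimodule `B`, with value `Hom_A(B.obj (op a), M)` at `a`. -/
def homFunctor (B : BiMod k V) : LMod k V ⥤ LMod k V :=
  (B.rightOp ⋙ linearCoyoneda k (LMod k V)).flip

/-- The functor `G_i = Hom_A((F_i I)^*, -)` on all modules. -/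
def bigG (i : V) : LMod k V ⥤ LMod k V :=
  homFunctor (dualBimod (injBimod k V ⋙ projFunctor i))

variable (k V) in
/-- The property of being finite dimensional (the quivers considered here are finite). -/
def isFD : ObjectProperty (LMod k V) := fun M => ∀ b, Module.Finite k (M.obj b)

variable (k V) in
/-- The category of finite dimensional left modules. -/
abbrev FDMod := (isFD k V).FullSubcategory

/-! From here on the quiver is finite and acyclic: it has finitely many vertices and
finitely many paths. -/

variable [Finite V] [∀ i j : V, Finite (Quiver.Path i j)]

theorem finite_path (i j : V) : Finite (Quiver.Path i j) := inferInstance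

theorem finite_injBimod (a : (Paths V)ᵒᵖ) (b : Paths V) :
    Module.Finite k (((injBimod k V).obj a).obj b) := by
  have : Finite (b ⟶ a.unop) := finite_path (V := V) b a.unop
  exact inferInstanceAs (Module.Finite k (Module.Dual k ((b ⟶ a.unop) →₀ k)))

theorem finite_dualBimod {B : BiMod k V} (hB : ∀ a b, Module.Finite k ((B.obj a).obj b))
    (a : (Paths V)ᵒᵖ) (b : Paths V) : Module.Finite k (((dualBimod B).obj a).obj b) :=
  have := hB (op b) a.unop
  inferInstanceAs (Module.Finite k (Module.Dual k ((B.obj (op b)).obj a.unop)))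

theorem finite_quotTrace (L N : LMod k V) (b : Paths V) [Module.Finite k (N.obj b)] :
    Module.Finite k (((quotTrace L).obj N).obj b) :=
  inferInstanceAs (Module.Finite k (N.obj b ⧸ trace L N b))

theorem finite_hom (N M : LMod k V) (hN : isFD k V N) (hM : isFD k V M) :
    Module.Finite k (N ⟶ M) := by
  have : Finite (Paths V) := inferInstanceAs (Finite V)
  have : ∀ b, Module.Finite k (N.obj b) := hN
  have : ∀ b, Module.Finite k (M.obj b) := hM
  let φ : (N ⟶ M) →ₗ[k] (∀ b, N.obj b →ₗ[k] M.obj b) :=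
    { toFun f b := (f.app b).hom
      map_add' f g := rfl
      map_smul' c f := rfl }
  refine Module.Finite.of_injective φ fun f g h => ?_
  ext b : 3
  exact congrFun h b

theorem bigG_isFD (i : V) (M : LMod k V) (hM : isFD k V M) : isFD k V ((bigG i).obj M) :=
  fun a => finite_hom _ M (finite_dualBimod (fun a b =>
    have := finite_injBimod (k := k) a b
    finite_quotTrace _ _ _) (op a)) hM

variable (k) in
/-- The endofunctor `G_i = Hom_A((F_i I)^*, -)` of the category of finite dimensional modules. -/
def G (i : V) : FDMod k V ⥤ FDMod k V :=
  (isFD k V).lift ((isFD k V).ι ⋙ bigG i) fun M => bigG_isFD i M.obj M.property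

variable (k) in
/-- The indecomposable injective module `I_i`, as a finite dimensional module. -/
def inj (i : V) : FDMod k V :=
  ⟨(injBimod k V).obj (op i), finite_injBimod (op i)⟩

instance (i : V) : (G k i).Additive where
  map_add {M N f g} := by
    apply ObjectProperty.hom_ext
    ext a : 2
    refine ModuleCat.hom_ext (LinearMap.ext fun φ => ?_)
    exact Preadditive.comp_add _ _ _ φ f.hom g.hom

end Modules

/-! ### The 2-category -/

section TwoCategory

variable {k : Type u} [Field k] {V : Type} [Quiver.{0} V]
  [Finite V] [∀ i j : V, Finite (Quiver.Path i j)]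
  {X : Type v} [Category.{w} X] [Abelian X] (e : X ≌ FDMod k V)

/-- The functor `G_i` transported to `X`. -/
def GX (i : V) : X ⥤ X := e.functor ⋙ G k i ⋙ e.inverse

/-- The composition `G_{i₁} ∘ G_{i₂} ∘ ⋯ ∘ G_{iᵣ}`; the empty composition is the identity. -/
def word : List V → (X ⥤ X)
  | [] => 𝟭 X
  | i :: l => word l ⋙ GX e i

/-- The 1-morphisms: the endofunctors of `X` isomorphic to a finite direct sum of
functors (empty sums allowed), each of which is a direct summand of a composition of `G_i`'s.
In the abelian category `X ⥤ X` a direct summand is the same as a retract. -/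
inductive IsOneMor : ObjectProperty (X ⥤ X)
  | summand {F : X ⥤ X} (l : List V) (r : Retract F (word e l)) : IsOneMor F
  | zero {F : X ⥤ X} (h : IsZero F) : IsOneMor F
  | sum {F F₁ F₂ : X ⥤ X} (h₁ : IsOneMor F₁) (h₂ : IsOneMor F₂) (i : F ≅ F₁ ⊞ F₂) : IsOneMor F

theorem word_append (l l' : List V) : Nonempty (word e (l ++ l') ≅ word e l' ⋙ word e l) := by
  induction l with
  | nil => exact ⟨(Functor.rightUnitor _).symm⟩
  | cons i l ih =>
    obtain ⟨α⟩ := ih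
    exact ⟨Functor.isoWhiskerRight α (GX e i) ≪≫ Functor.associator _ _ _⟩

theorem functor_additive : e.functor.Additive :=
  Functor.additive_of_preserves_binary_products _

theorem GX_additive (i : V) : (GX e i).Additive := by
  have := functor_additive e
  unfold GX
  infer_instance

theorem word_additive (l : List V) : (word e l).Additive := by
  induction l with
  | nil => exact inferInstanceAs (𝟭 X).Additive
  | cons i l ih =>
    have := GX_additive e i
    exact inferInstanceAs (word e l ⋙ GX e i).Additive

theorem additive_of_retract {F F' : X ⥤ X} (r : Retract F F') [F'.Additive] : F.Additive where
  map_add {A B f g} := by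
    have h (f : A ⟶ B) : F.map f = r.i.app A ≫ F'.map f ≫ r.r.app B := by
      have h2 : r.i.app A ≫ r.r.app A = 𝟙 (F.obj A) := congrArg (fun t => t.app A) r.retract
      rw [r.r.naturality, ← Category.assoc, h2, Category.id_comp]
    rw [h, h f, h g]
    simp only [Functor.map_add, Preadditive.comp_add, Preadditive.add_comp]

theorem additive_of_decomposition {F F₁ F₂ : X ⥤ X} [F₁.Additive] [F₂.Additive]
    (a₁ : F ⟶ F₁) (b₁ : F₁ ⟶ F) (a₂ : F ⟶ F₂) (b₂ : F₂ ⟶ F) (h : a₁ ≫ b₁ + a₂ ≫ b₂ = 𝟙 F) :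
    F.Additive where
  map_add {A B f g} := by
    have h' (f : A ⟶ B) : F.map f =
        a₁.app A ≫ F₁.map f ≫ b₁.app B + a₂.app A ≫ F₂.map f ≫ b₂.app B := by
      rw [b₁.naturality, b₂.naturality, ← Category.assoc, ← Category.assoc,
        ← Preadditive.add_comp]
      have h2 : a₁.app A ≫ b₁.app A + a₂.app A ≫ b₂.app A = 𝟙 (F.obj A) :=
        congrArg (fun t => t.app A) h
      rw [h2, Category.id_comp]
    rw [h', h' f, h' g]
    simp only [Functor.map_add, Preadditive.comp_add, Preadditive.add_comp]
    abel

theorem whiskerLeft_additive (F : X ⥤ X) : ((Functor.whiskeringLeft X X X).obj F).Additive where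

theorem whiskerRight_additive (F : X ⥤ X) [F.Additive] :
    ((Functor.whiskeringRight X X X).obj F).Additive where
  map_add {A B f g} := by
    ext x
    exact F.map_add

theorem IsOneMor.additive {F : X ⥤ X} (hF : IsOneMor e F) : F.Additive := by
  induction hF with
  | summand l r =>
    have := word_additive e l
    exact additive_of_retract r
  | zero h => exact ⟨fun {A B f g} => ((h.obj A).eq_of_src _ _)⟩
  | @sum F F₁ F₂ h₁ h₂ i ih₁ ih₂ =>
    have h1 : (i.hom ≫ biprod.fst) ≫ biprod.inl ≫ i.inv +
        (i.hom ≫ biprod.snd) ≫ biprod.inr ≫ i.inv = 𝟙 F := by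
      have := congrArg (fun t => i.hom ≫ t ≫ i.inv) (biprod.total (X := F₁) (Y := F₂))
      simp only [Preadditive.comp_add, Preadditive.add_comp, Category.assoc, Category.id_comp,
        Iso.hom_inv_id] at this ⊢
      exact this
    exact additive_of_decomposition _ _ _ _ h1

theorem IsOneMor.of_iso {F F' : X ⥤ X} (hF : IsOneMor e F) (i : F' ≅ F) : IsOneMor e F' := by
  cases hF with
  | summand l r => exact .summand l ((Retract.ofIso i).trans r)
  | zero h => exact .zero (h.of_iso i)
  | sum h₁ h₂ j => exact .sum h₁ h₂ (i ≪≫ j)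

/-- Compositions of 1-morphisms are 1-morphisms. -/
theorem IsOneMor.comp {F F' : X ⥤ X} (hF : IsOneMor e F) (hF' : IsOneMor e F') :
    IsOneMor e (F ⋙ F') := by
  induction hF' with
  | zero h => exact .zero (Functor.isZero _ fun A => h.obj _)
  | @sum G G₁ G₂ h₁ h₂ i ih₁ ih₂ =>
    have := whiskerLeft_additive F
    have := preservesBinaryBiproducts_of_preservesBiproducts ((Functor.whiskeringLeft X X X).obj F)
    exact .sum ih₁ ih₂ (Functor.isoWhiskerLeft F i ≪≫
      ((Functor.whiskeringLeft X X X).obj F).mapBiprod G₁ G₂)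
  | @summand G l' r' =>
    have hG : G.Additive := IsOneMor.additive e (.summand l' r')
    induction hF with
    | zero h => exact .zero (Functor.isZero _ fun A => G.map_isZero (h.obj A))
    | @sum H H₁ H₂ h₁ h₂ i ih₁ ih₂ =>
      have := whiskerRight_additive G
      have := preservesBinaryBiproducts_of_preservesBiproducts ((Functor.whiskeringRight X X X).obj G)
      exact .sum ih₁ ih₂ (Functor.isoWhiskerRight i G ≪≫
        ((Functor.whiskeringRight X X X).obj G).mapBiprod H₁ H₂)
    | @summand H l r =>
      obtain ⟨α⟩ := word_append e l' l
      exact .summand (l' ++ l) (((r.map ((Functor.whiskeringRight X X X).obj G)).trans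
        (r'.map ((Functor.whiskeringLeft X X X).obj (word e l)))).trans (Retract.ofIso α.symm))

/-- The category of 1-morphisms and 2-morphisms of the 2-category with the single object `X`:
the 1-morphisms are those above and the 2-morphisms are all natural transformations. -/
abbrev GCat := (IsOneMor e).FullSubcategory

instance : (IsOneMor e).IsClosedUnderFiniteProducts := by
  have h0 : (IsOneMor e).ContainsZero := ⟨⟨_, isZero_zero _, .zero (isZero_zero _)⟩⟩
  have h1 : (IsOneMor e).IsClosedUnderIsomorphisms := ⟨fun i h => h.of_iso e i.symm⟩
  have h2 : (IsOneMor e).IsClosedUnderBinaryProducts := by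
    refine ⟨fun F ⟨p⟩ => ?_⟩
    refine .sum (p.prop_diag_obj (.mk .left)) (p.prop_diag_obj (.mk .right)) ?_
    exact IsLimit.conePointUniqueUpToIso
      ((IsLimit.postcomposeHomEquiv (diagramIsoPair p.diag) _).2 p.isLimit)
      (BinaryBiproduct.isLimit _ _)
  exact .mk'

instance : HasBinaryBiproducts (GCat e) :=
  have : HasFiniteBiproducts (GCat e) := HasFiniteBiproducts.of_hasFiniteProducts
  hasBinaryBiproducts_of_finite_biproducts _

variable {e}

/-- The identity 1-morphism. -/
def GCat.id : GCat e := ⟨𝟭 X, .summand [] (Retract.refl _)⟩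

/-- The composition `F ∘ F'` of 1-morphisms. -/
def GCat.comp (F F' : GCat e) : GCat e := ⟨F'.obj ⋙ F.obj, .comp e F'.property F.property⟩

variable (e) in
/-- The 1-morphism `G_i`. -/
def GCat.gen (i : V) : GCat e := ⟨GX e i, .summand [i] (Retract.ofIso (Functor.leftUnitor _).symm)⟩

end TwoCategory

/-! ### Isomorphism classes and Grothendieck groups -/

section Grothendieck

/-- The set of isomorphism classes of objects of a category. -/
abbrev IsoCl (C : Type v) [Category.{w} C] : Type v := Quotient (isIsomorphicSetoid C)

/-- The isomorphism class of an object. -/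
def cls {C : Type v} [Category.{w} C] (A : C) : IsoCl C := Quotient.mk _ A

theorem cls_eq {C : Type v} [Category.{w} C] {A B : C} (i : A ≅ B) : cls A = cls B :=
  Quotient.sound ⟨i⟩

/-- The relations `[A ⊞ B] = [A] + [B]` of the split Grothendieck group of an additive category,
as a subgroup of the free abelian group on the isomorphism classes. -/
def splitRel (C : Type v) [Category.{w} C] [Preadditive C] [HasBinaryBiproducts C] :
    AddSubgroup (FreeAbelianGroup (IsoCl C)) :=
  AddSubgroup.closure {x | ∃ A B : C, x = FreeAbelianGroup.of (cls (A ⊞ B)) -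
    FreeAbelianGroup.of (cls A) - FreeAbelianGroup.of (cls B)}

/-- The relations `[B] = [A] + [C]` of the Grothendieck group of an abelian category, one for each
short exact sequence `0 ⟶ A ⟶ B ⟶ C ⟶ 0`. -/
def exactRel (C : Type v) [Category.{w} C] [Abelian C] :
    AddSubgroup (FreeAbelianGroup (IsoCl C)) :=
  AddSubgroup.closure {x | ∃ S : ShortComplex C, S.ShortExact ∧ x = FreeAbelianGroup.of (cls S.X₂) -
    FreeAbelianGroup.of (cls S.X₁) - FreeAbelianGroup.of (cls S.X₃)}

/-- The Grothendieck group of an abelian category. -/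
abbrev GrAb (C : Type v) [Category.{w} C] [Abelian C] : Type v :=
  FreeAbelianGroup (IsoCl C) ⧸ exactRel C

/-- The class of an object in the Grothendieck group. -/
def GrAb.mk {C : Type v} [Category.{w} C] [Abelian C] (A : C) : GrAb C :=
  QuotientAddGroup.mk (FreeAbelianGroup.of (cls A))

variable {k : Type u} [Field k] {V : Type} [Quiver.{0} V]
  [Finite V] [∀ i j : V, Finite (Quiver.Path i j)]
  {X : Type v} [Category.{w} X] [Abelian X] (e : X ≌ FDMod k V)

variable {e} in
/-- The functor `F ∘ -` on 1-morphisms. -/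
def GCat.postcomp (F : GCat e) : GCat e ⥤ GCat e where
  obj F' := F.comp F'
  map t := ObjectProperty.homMk (Functor.whiskerRight t.hom F.obj)

variable {e} in
/-- The functor `- ∘ F` on 1-morphisms. -/
def GCat.precomp (F : GCat e) : GCat e ⥤ GCat e where
  obj F' := F'.comp F
  map t := ObjectProperty.homMk (Functor.whiskerLeft F.obj t.hom)

instance (F : GCat e) : F.postcomp.Additive where
  map_add {A B f g} := by
    have := IsOneMor.additive e F.property
    apply ObjectProperty.hom_ext
    ext x
    exact F.obj.map_add

instance (F : GCat e) : F.precomp.Additive where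

/-- The monoid of isomorphism classes of 1-morphisms, with multiplication `[F] * [F'] = [F ∘ F']`
induced by composition. -/
instance : Monoid (IsoCl (GCat e)) where
  mul := Quotient.map₂ GCat.comp fun F F₁ ⟨i⟩ F' F₁' ⟨j⟩ =>
    ⟨F.postcomp.mapIso j ≪≫ F₁'.precomp.mapIso i⟩
  one := cls GCat.id
  mul_assoc a b c := by
    induction a, b, c using Quotient.inductionOn₃ with
    | _ F₁ F₂ F₃ => exact cls_eq (ObjectProperty.isoMk _ (Functor.associator _ _ _).symm)
  one_mul a := by
    induction a using Quotient.inductionOn with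
    | _ F => exact cls_eq (ObjectProperty.isoMk _ (Functor.rightUnitor _))
  mul_one a := by
    induction a using Quotient.inductionOn with
    | _ F => exact cls_eq (ObjectProperty.isoMk _ (Functor.leftUnitor _))

theorem cls_mul (F F' : GCat e) : cls F * cls F' = cls (F.comp F') := rfl

theorem splitRel_mul (a b : FreeAbelianGroup (IsoCl (GCat e))) (hb : b ∈ splitRel (GCat e)) :
    a * b ∈ splitRel (GCat e) := by
  induction a using FreeAbelianGroup.induction_on with
  | zero => simp [zero_mem]
  | neg x h => rw [neg_mul]; exact neg_mem h
  | add x y hx hy => rw [add_mul]; exact add_mem hx hy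
  | of x =>
    induction x using Quotient.inductionOn with
    | _ F =>
      refine AddSubgroup.closure_induction (p := fun b _ => FreeAbelianGroup.of _ * b ∈ splitRel _)
        ?_ (by simp [zero_mem]) (fun x y _ _ hx hy => by rw [mul_add]; exact add_mem hx hy)
        (fun x _ hx => by rw [mul_neg]; exact neg_mem hx) hb
      rintro _ ⟨A, B, rfl⟩
      refine AddSubgroup.subset_closure ⟨F.comp A, F.comp B, ?_⟩
      have := preservesBinaryBiproducts_of_preservesBiproducts F.postcomp
      have h : cls (GCat.comp F (A ⊞ B)) = cls (F.comp A ⊞ F.comp B) := cls_eq (F.postcomp.mapBiprod A B)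
      rw [mul_sub, mul_sub, FreeAbelianGroup.of_mul_of, FreeAbelianGroup.of_mul_of,
        FreeAbelianGroup.of_mul_of, ← h]
      rfl

theorem mul_splitRel (a b : FreeAbelianGroup (IsoCl (GCat e))) (hb : b ∈ splitRel (GCat e)) :
    b * a ∈ splitRel (GCat e) := by
  induction a using FreeAbelianGroup.induction_on with
  | zero => simp [zero_mem]
  | neg x h => rw [mul_neg]; exact neg_mem h
  | add x y hx hy => rw [mul_add]; exact add_mem hx hy
  | of x =>
    induction x using Quotient.inductionOn with
    | _ F =>
      refine AddSubgroup.closure_induction (p := fun b _ => b * FreeAbelianGroup.of _ ∈ splitRel _)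
        ?_ (by simp [zero_mem]) (fun x y _ _ hx hy => by rw [add_mul]; exact add_mem hx hy)
        (fun x _ hx => by rw [neg_mul]; exact neg_mem hx) hb
      rintro _ ⟨A, B, rfl⟩
      refine AddSubgroup.subset_closure ⟨A.comp F, B.comp F, ?_⟩
      have := preservesBinaryBiproducts_of_preservesBiproducts F.precomp
      have h : cls (GCat.comp (A ⊞ B) F) = cls (A.comp F ⊞ B.comp F) := cls_eq (F.precomp.mapBiprod A B)
      rw [sub_mul, sub_mul, FreeAbelianGroup.of_mul_of, FreeAbelianGroup.of_mul_of,
        FreeAbelianGroup.of_mul_of, ← h]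
      rfl

/-- The relations of the split Grothendieck group form a two-sided ideal for the multiplication
induced by composition. -/
def splitIdeal : TwoSidedIdeal (FreeAbelianGroup (IsoCl (GCat e))) :=
  .mk' (splitRel (GCat e)) (zero_mem _) add_mem neg_mem (splitRel_mul e _ _) (mul_splitRel e _ _)

/-- The endomorphism ring of the unique object of the Grothendieck category of the 2-category: the
split Grothendieck group of the category of 1-morphisms, with the multiplication induced by
composition of 1-morphisms. -/
abbrev GrG : Type _ := (splitIdeal e).ringCon.Quotient

variable {e}

/-- The class of a 1-morphism in the Grothendieck ring. -/
def GrG.mk (F : GCat e) : GrG e := (splitIdeal e).ringCon.mk' (FreeAbelianGroup.of (cls F))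

variable (e) in
/-- The isomorphism classes of the 1-morphisms that are indecomposable or zero. -/
def indecClasses : Set (IsoCl (GCat e)) :=
  {x | ∃ F : GCat e, x = cls F ∧ (Indecomposable F ∨ IsZero F)}

end Grothendieck

/-- The contracted integral monoid ring of the Catalan monoid: the quotient of the integral monoid
ring by the ideal spanned by the zero element of the monoid. -/
abbrev ContractedRing (m : ℕ) : Type :=
  (TwoSidedIdeal.span {MonoidAlgebra.of ℤ (catalan (m + 1)) (catalanZero m)}).ringCon.Quotient

/-- The class of an element of the Catalan monoid in the contracted monoid ring. -/
def ContractedRing.mk {m : ℕ} (f : catalan (m + 1)) : ContractedRing m :=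
  RingCon.mk' _ (MonoidAlgebra.of ℤ (catalan (m + 1)) f)

end CatalanCat
end

noncomputable section

namespace CatalanCat

/-! ### Adjoints and generators in the Catalan monoid -/

section Combinatorics

variable {m : ℕ}

/-! An order-preserving and order-decreasing map f of the chain 0 < ... < m fixes 0, so it has a
right adjoint f♯ with i ≤ f♯(j) if and only if f(i) ≤ j; this is `sharp f`. Extend a representation
M of the linear quiver by zero to all natural numbers and put (R_f M)_j = M_{f♯(j)}. Taking adjoints
and restricting along a map both reverse compositions, so R_f ∘ R_{f'} ≅ R_{ff'} (`catRestrMul`).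

The functor G_i is R_{α_i}. The injective I_b is at most one-dimensional at each vertex and has
socle L_b, so F_i changes only I_i, where it removes the value at i. Hence the left module that (F_i
I)^* has at a is one-dimensional exactly at the vertices b ≥ α_i♯(a), with bijective maps between
them. It is the projective at α_i♯(a), or zero if α_i♯(a) = m, and homomorphisms from it to M form
M_{α_i♯(a)} (`bigGIso`). Since the α_i generate the monoid (`exists_alpha_word`), the compositions
of the G_i are, up to isomorphism, exactly the R_f.

By the Yoneda argument on projectives, every natural endomorphism of R_f is a scalar
(`exists_scalar`), hence zero or invertible. So R_f is indecomposable or zero, a retract of R_f is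
zero or isomorphic to R_f, and every 1-morphism is a finite direct sum of functors R_f
(`gcat_induction`). Evaluation on projectives recovers f♯, hence f (`eq_of_catRestr_iso`), and R_f
vanishes only for the zero element. This describes the monoid of indecomposable or zero classes. In
the Grothendieck ring the nonzero R_f are linearly independent because the multiplicity `mult` of
R_f is additive on direct sums (`contractedToGrG_injective`).

For the action, the dimension of R_f M at j is that of M at f♯(j). Classes in the Grothendieck group
of the abelian category are determined by dimension vectors d, and I_c has d_j = 1 for j ≤ c and 0
beyond, so the coordinates in the injectives are the drops d_r - d_{r+1}. The drop of R_f M at r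
telescopes into the drops of M at all c with f♯(r) ≤ c < f♯(r+1), that is with f(c+1) = r+1: this is
the natural representation (`naturalRep_mulVec`). -/

theorem catalan_zero (f : catalan (m + 1)) : f.1 0 = 0 := Fin.le_zero_iff.1 (f.2.2 0)

theorem catalan_mul_apply (f f' : catalan (m + 1)) (i : Fin (m + 1)) :
    (f * f').1 i = f.1 (f'.1 i) := rfl

theorem catalan_ext {f f' : catalan (m + 1)} (h : ∀ i, f.1 i = f'.1 i) : f = f' :=
  Subtype.ext (funext h)

/-- The right adjoint of an element of the Catalan monoid, extended to the natural numbers. -/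
def sharp (f : catalan (m + 1)) : ℕ →o ℕ where
  toFun j := Nat.findGreatest (fun i => (f.1 (Fin.ofNat (m + 1) i)).val ≤ j) m
  monotone' _ _ h := Nat.findGreatest_mono_left (fun _ hi => le_trans hi h) m

theorem sharp_le (f : catalan (m + 1)) (j : ℕ) : sharp f j ≤ m := Nat.findGreatest_le m

/-- As f is monotone and fixes 0, the set searched by `Nat.findGreatest` is a nonempty initial
segment of the chain. Later arguments handle `sharp` only through this adjunction, the bound
`sharp_le` and monotonicity. -/
theorem le_sharp_iff (f : catalan (m + 1)) (i : Fin (m + 1)) (j : ℕ) :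
    i.val ≤ sharp f j ↔ (f.1 i).val ≤ j := by
  have hi : Fin.ofNat (m + 1) i.val = i := Fin.ext (Nat.mod_eq_of_lt i.2)
  constructor
  · intro h
    have h0 : (fun i => (f.1 (Fin.ofNat (m + 1) i)).val ≤ j) 0 := by
      have : Fin.ofNat (m + 1) 0 = 0 := rfl
      simp only [this, catalan_zero]
      exact Nat.zero_le _
    have h1 := Nat.findGreatest_spec (P := fun i => (f.1 (Fin.ofNat (m + 1) i)).val ≤ j)
      (Nat.zero_le m) h0
    refine le_trans ?_ h1
    refine Fin.le_def.1 (f.2.1 (Fin.le_def.2 ?_))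
    have := sharp_le f j
    exact le_of_le_of_eq h (Nat.mod_eq_of_lt (Nat.lt_succ_of_le this)).symm
  · intro h
    refine Nat.le_findGreatest (Nat.le_of_lt_succ i.2) ?_
    rwa [hi]

/-- Uniqueness of adjoints. The bound on c is needed since only points of the chain are tested. -/
theorem eq_sharp {f : catalan (m + 1)} {j c : ℕ} (hc : c ≤ m)
    (h : ∀ i : Fin (m + 1), i.val ≤ c ↔ (f.1 i).val ≤ j) : sharp f j = c := by
  apply le_antisymm
  · exact (h ⟨sharp f j, Nat.lt_succ_of_le (sharp_le f j)⟩).2 ((le_sharp_iff f _ j).1 le_rfl)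
  · exact (le_sharp_iff f ⟨c, Nat.lt_succ_of_le hc⟩ j).2 ((h _).1 le_rfl)

/-- The restriction on j reflects the cap at m: on all of ℕ the adjoint of 1 is not the identity. -/
theorem sharp_one {j : ℕ} (hj : j < m) : sharp (1 : catalan (m + 1)) j = j :=
  eq_sharp hj.le fun _ => Iff.rfl

theorem sharp_mul (f f' : catalan (m + 1)) : sharp (f * f') = (sharp f').comp (sharp f) := by
  refine OrderHom.ext _ _ (funext fun j => eq_sharp (sharp_le _ _) fun i => ?_)
  rw [OrderHom.comp_coe, Function.comp_apply, le_sharp_iff, le_sharp_iff, catalan_mul_apply]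

/-- Beyond the quiver the adjoint takes the value m, so a restriction extended by zero is again a
restriction of the extension by zero. This is the hypothesis of `restrComp`. -/
theorem lt_of_sharp_lt (f : catalan (m + 1)) {j : ℕ} (h : sharp f j < m) : j < m := by
  by_contra hj
  have : m ≤ sharp f j := (le_sharp_iff f (Fin.last m) j).2
    ((Fin.le_def.1 (f.2.2 (Fin.last m))).trans (not_lt.1 hj))
  omega

theorem sharp_alpha_self (i : Fin m) : sharp (alpha i) i = i + 1 := by
  refine eq_sharp i.2 fun j => ?_
  simp only [alpha]
  split_ifs with h
  · simp [h]
  · have : j.val ≠ i.val + 1 := fun h' => h (Fin.ext h')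
    omega

theorem sharp_alpha_of_ne (i : Fin m) {b : ℕ} (hb : b < m) (h : b ≠ i) :
    sharp (alpha i) b = b := by
  refine eq_sharp hb.le fun j => ?_
  simp only [alpha]
  split_ifs with hj
  · simp only [hj, Fin.val_succ, Fin.val_castSucc]
    omega
  · rfl

/-- The adjoint determines f, and arguments j ≥ m carry no information because all values of f are
at most m. -/
theorem sharp_injective {f f' : catalan (m + 1)} (h : ∀ j < m, sharp f j = sharp f' j) :
    f = f' := by
  refine catalan_ext fun i => Fin.ext (eq_of_forall_ge_iff fun j => ?_)
  rcases lt_or_ge j m with hj | hj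
  · rw [← le_sharp_iff, ← le_sharp_iff, h j hj]
  · have h1 := (f.1 i).is_le
    have h2 := (f'.1 i).is_le
    omega

theorem sharp_zero_eq_iff (f : catalan (m + 1)) : m ≤ sharp f 0 ↔ f = catalanZero m := by
  refine (le_sharp_iff f (Fin.last m) 0).trans ?_
  constructor
  · intro h
    refine catalan_ext fun i => ?_
    have := Fin.le_def.1 (f.2.1 (Fin.le_last i))
    exact Fin.ext (Nat.le_zero.1 (this.trans h))
  · rintro rfl
    exact le_rfl

/-- Let j be the largest point moved by f, raise f(j) by one to get f', and undo the change with the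
generator at f(j). That generator affects no other value: points below j go to at most f(j), and
points above j are fixed, so exceed f(j) + 1. -/
theorem alpha_mul_catalan {f : catalan (m + 1)} (hf : f ≠ 1) :
    ∃ (i : Fin m) (f' : catalan (m + 1)), f = alpha i * f' ∧
      ∑ j, (f.1 j).val < ∑ j, (f'.1 j).val := by
  classical
  have hne : (Finset.univ.filter fun j => f.1 j ≠ j).Nonempty := by
    by_contra h
    rw [Finset.not_nonempty_iff_eq_empty, Finset.filter_eq_empty_iff] at h
    exact hf (catalan_ext fun i => not_not.1 (h (Finset.mem_univ i)))
  obtain ⟨j, hj, hmax⟩ := Finset.exists_max_image _ id hne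
  rw [Finset.mem_filter] at hj
  have hlt : f.1 j < j := lt_of_le_of_ne (f.2.2 j) hj.2
  have hfix : ∀ x, j < x → f.1 x = x := fun x hx => by
    by_contra h
    exact absurd (hmax x (by simp [h])) (not_le.2 hx)
  have hjm : (f.1 j).val < m := lt_of_lt_of_le (Fin.lt_def.1 hlt) j.is_le
  let i : Fin m := ⟨(f.1 j).val, hjm⟩
  let f' : catalan (m + 1) := ⟨fun x => if x = j then i.succ else f.1 x, by
    constructor
    · intro a b hab
      dsimp only
      split_ifs with h1 h2 h2
      · exact le_rfl
      · rw [h1] at hab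
        have := lt_of_le_of_ne hab (Ne.symm h2)
        rw [hfix b this]
        simp only [i, Fin.le_def, Fin.lt_def, Fin.val_succ] at *
        omega
      · rw [h2] at hab
        have := f.2.1 hab
        simp only [i, Fin.le_def, Fin.val_succ] at *
        omega
      · exact f.2.1 hab
    · intro a
      dsimp only
      split_ifs with h1
      · subst h1
        exact hlt
      · exact f.2.2 a⟩
  refine ⟨i, f', catalan_ext fun x => ?_, ?_⟩
  · rw [catalan_mul_apply]
    simp only [alpha, f']
    rcases eq_or_ne x j with rfl | hx
    · simp [i]
    · rw [if_neg hx, if_neg]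
      intro h
      have h' : (f.1 x).val = (f.1 j).val + 1 := congrArg Fin.val h
      rcases lt_or_gt_of_ne hx with h1 | h1
      · have := Fin.le_def.1 (f.2.1 h1.le)
        omega
      · rw [hfix x h1] at h'
        simp only [Fin.lt_def] at h1 hlt
        omega
  · refine Finset.sum_lt_sum (fun x _ => ?_) ⟨j, Finset.mem_univ j, ?_⟩
    · simp only [f']
      split_ifs with h
      · simp [h, i]
      · exact le_rfl
    · simp [f', i]

theorem exists_alpha_word (f : catalan (m + 1)) : ∃ l : List (Fin m), f = (l.map alpha).prod := by
  -- The sum of the values is at most (m + 1) * m and grows whenever a generator is split off, so N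
  -- bounds the number of remaining steps.
  have key : ∀ (N : ℕ) (f : catalan (m + 1)), (m + 1) * m ≤ ∑ j, (f.1 j).val + N →
      ∃ l : List (Fin m), f = (l.map alpha).prod := by
    intro N
    induction N with
    | zero =>
      intro f hf
      by_cases h : f = 1
      · exact ⟨[], h⟩
      · obtain ⟨i, f', -, hlt⟩ := alpha_mul_catalan h
        have : ∑ j, (f'.1 j).val ≤ (m + 1) * m := by
          refine (Finset.sum_le_card_nsmul _ _ m fun j _ => (f'.1 j).is_le).trans ?_
          simp
        omega
    | succ N ih =>
      intro f hf
      by_cases h : f = 1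
      · exact ⟨[], h⟩
      · obtain ⟨i, f', rfl, hlt⟩ := alpha_mul_catalan h
        obtain ⟨l, rfl⟩ := ih f' (by omega)
        exact ⟨i :: l, rfl⟩
  exact key _ f (Nat.le_add_left _ _)

end Combinatorics

/-! ### Restriction functors -/

section Restriction

variable {k : Type u} [Field k] {m : ℕ}

/-- The vertex `j` of the linear quiver, as an object of the path category. -/
abbrev vtx (j : ℕ) (h : j < m) : Paths (LinearQuiver m) := (⟨j, h⟩ : Fin m)

/-- The number of a vertex. -/
abbrev vnum (a : Paths (LinearQuiver m)) : ℕ := Fin.val (n := m) a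

theorem vnum_lt (a : Paths (LinearQuiver m)) : vnum a < m := Fin.is_lt (n := m) a

theorem vnum_le {a b : Paths (LinearQuiver m)} (p : a ⟶ b) : vnum a ≤ vnum b :=
  LinearQuiver.le_of_path p

theorem vnum_injective {a b : Paths (LinearQuiver m)} (h : vnum a = vnum b) : a = b :=
  Fin.ext (n := m) h

instance (a b : Paths (LinearQuiver m)) : Subsingleton (a ⟶ b) := ⟨LinearQuiver.path_eq⟩

theorem nonempty_path {i j : ℕ} (h : i ≤ j) (hj : j < m) :
    Nonempty (vtx i (h.trans_lt hj) ⟶ vtx j hj) := by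
  induction j, h using Nat.le_induction with
  | base => exact ⟨𝟙 _⟩
  | succ j hij ih =>
    obtain ⟨p⟩ := ih (by omega)
    exact ⟨Quiver.Path.cons p ⟨rfl⟩⟩

/-- The path between two vertices of the linear quiver. -/
def lpath {a b : Paths (LinearQuiver m)} (h : vnum a ≤ vnum b) : a ⟶ b :=
  (nonempty_path h (vnum_lt b)).some

/-- The extension of a representation of the linear quiver by zero. -/
def hatObj (M : LMod k (LinearQuiver m)) : ℕ ⥤ ModuleCat.{u} k where
  -- Functions on the proofs of j < m: the value of M at j inside the quiver and zero outside,
  -- without a case distinction.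
  obj j := ModuleCat.of k ((h : PLift (j < m)) → M.obj (vtx j h.down))
  map {i j} f := ModuleCat.ofHom
    { toFun φ h := (M.map (lpath (a := vtx i (f.le.trans_lt h.down)) (b := vtx j h.down) f.le)).hom
        (φ ⟨f.le.trans_lt h.down⟩)
      map_add' φ ψ := by
        funext h
        simp
      map_smul' c φ := by
        funext h
        simp }
  map_id j := by
    refine ModuleCat.hom_ext (LinearMap.ext fun φ => funext fun h => ?_)
    change (M.map _).hom (φ h) = φ h
    exact congrArg (fun t => t.hom (φ h))
      ((congrArg M.map (Subsingleton.elim _ (𝟙 _))).trans (M.map_id _))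
  map_comp {i j l} f g := by
    refine ModuleCat.hom_ext (LinearMap.ext fun φ => funext fun h => ?_)
    change (M.map _).hom _ = (M.map _).hom ((M.map _).hom _)
    rw [← LinearMap.comp_apply, ← ModuleCat.hom_comp, ← M.map_comp]
    exact congrArg (fun p => (M.map p).hom _) (Subsingleton.elim _ _)

/-- The functor extending representations of the linear quiver by zero. -/
def hat (k : Type u) [Field k] (m : ℕ) : LMod k (LinearQuiver m) ⥤ (ℕ ⥤ ModuleCat.{u} k) where
  obj := hatObj
  map {M N} η :=
    { app j := ModuleCat.ofHom
        { toFun φ h := (η.app (vtx j h.down)).hom (φ h)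
          map_add' φ ψ := by
            funext h
            simp
          map_smul' c φ := by
            funext h
            simp }
      naturality i j f := by
        refine ModuleCat.hom_ext (LinearMap.ext fun φ => funext fun h => ?_)
        exact congrArg (fun t => t.hom (φ ⟨f.le.trans_lt h.down⟩))
          (η.naturality (lpath (a := vtx i (f.le.trans_lt h.down)) (b := vtx j h.down) f.le)) }

/-- A monotone map as a functor from the path category of the linear quiver. -/
def pathsToNat (m : ℕ) (g : ℕ →o ℕ) : Paths (LinearQuiver m) ⥤ ℕ where
  obj b := g (vnum b)
  map p := homOfLE (g.monotone (vnum_le p))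

/-- Restriction along a monotone map of the extensions by zero. -/
def restr (k : Type u) [Field k] (m : ℕ) (g : ℕ →o ℕ) :
    LMod k (LinearQuiver m) ⥤ LMod k (LinearQuiver m) :=
  hat k m ⋙ (Functor.whiskeringLeft _ _ _).obj (pathsToNat m g)

/-- Restriction only depends on the values at the vertices. -/
def restrCongr {g g' : ℕ →o ℕ} (h : ∀ b < m, g b = g' b) : restr k m g ≅ restr k m g' :=
  Functor.isoWhiskerLeft _ ((Functor.whiskeringLeft _ _ _).mapIso
    (NatIso.ofComponents (fun b => eqToIso (h _ (vnum_lt b))) fun _ => Subsingleton.elim _ _))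

/-- Restriction along the identity. -/
def restrId : restr k m OrderHom.id ≅ 𝟭 (LMod k (LinearQuiver m)) :=
  NatIso.ofComponents (fun M => NatIso.ofComponents (fun b => LinearEquiv.toModuleIso
    { toFun φ := φ ⟨vnum_lt b⟩
      invFun x _ := x
      map_add' _ _ := rfl
      map_smul' _ _ := rfl
      left_inv _ := rfl
      right_inv _ := rfl })
    (fun {a b} p => by
      refine ModuleCat.hom_ext (LinearMap.ext fun φ => ?_)
      change (M.map _).hom _ = (M.map _).hom _
      exact congrArg (fun p => (M.map p).hom _) (Subsingleton.elim _ _)))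
    (fun _ => rfl)

/-- The extension by zero of a restriction. -/
def hatRestr (g : ℕ →o ℕ) (hg : ∀ j, g j < m → j < m) :
    restr k m g ⋙ hat k m ≅ hat k m ⋙ (Functor.whiskeringLeft _ _ _).obj g.monotone.functor :=
  NatIso.ofComponents (fun _ => NatIso.ofComponents (fun j => LinearEquiv.toModuleIso
    { toFun φ h := φ ⟨hg j h.down⟩ h
      invFun ψ _ := ψ
      map_add' _ _ := rfl
      map_smul' _ _ := rfl
      left_inv _ := rfl
      right_inv _ := rfl })
    (fun _ => rfl))
    (fun _ => rfl)

/-- Restriction along a composition. -/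
def restrComp (g g' : ℕ →o ℕ) (hg : ∀ j, g j < m → j < m) :
    restr k m g ⋙ restr k m g' ≅ restr k m (g.comp g') :=
  Functor.isoWhiskerRight (hatRestr g hg) ((Functor.whiskeringLeft _ _ _).obj (pathsToNat m g'))

theorem isFD_restr (g : ℕ →o ℕ) (M : LMod k (LinearQuiver m)) (hM : isFD k _ M) :
    isFD k _ ((restr k m g).obj M) := fun b =>
  have : ∀ a, Module.Finite k (M.obj a) := hM
  inferInstanceAs (Module.Finite k ((h : PLift (g (vnum b) < m)) → M.obj (vtx _ h.down)))

/-- The restriction functor of an element of the Catalan monoid on finite dimensional modules. -/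
def catRestr (k : Type u) [Field k] {m : ℕ} (f : catalan (m + 1)) :
    FDMod k (LinearQuiver m) ⥤ FDMod k (LinearQuiver m) :=
  (isFD k _).lift ((isFD k _).ι ⋙ restr k m (sharp f)) fun M =>
    isFD_restr _ M.obj M.property

/-- Lifting isomorphisms of functors to finite dimensional modules. -/
def liftIso {F F' : FDMod k (LinearQuiver m) ⥤ FDMod k (LinearQuiver m)}
    (i : F ⋙ (isFD k _).ι ≅ F' ⋙ (isFD k _).ι) : F ≅ F' :=
  ((isFD k (LinearQuiver m)).fullyFaithfulι.whiskeringRight _).preimageIso i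

/-- The restriction functor of the identity. -/
def catRestrOne : catRestr k (1 : catalan (m + 1)) ≅ 𝟭 _ :=
  liftIso (Functor.isoWhiskerLeft (isFD k _).ι (restrCongr (fun _ hb => sharp_one hb) ≪≫ restrId))

/-- The restriction functor of a product. -/
def catRestrMul (f f' : catalan (m + 1)) :
    catRestr k f' ⋙ catRestr k f ≅ catRestr k (f * f') :=
  liftIso (Functor.isoWhiskerLeft (isFD k _).ι
    (restrComp (sharp f') (sharp f) (fun _ => lt_of_sharp_lt f') ≪≫
      eqToIso (congrArg _ (sharp_mul f f').symm)))

end Restriction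

/-! ### The functors `G_i` as restrictions -/

section Simple

variable {k : Type u} [Field k] {m : ℕ}

/-- A homomorphism of modules given by a natural family of linear maps. -/
def homOfLin {M N : LMod k (LinearQuiver m)} (φ : ∀ b, M.obj b →ₗ[k] N.obj b)
    (h : ∀ (b b' : Paths (LinearQuiver m)) (p : b ⟶ b') (x : M.obj b),
      φ b' ((M.map p).hom x) = (N.map p).hom (φ b x)) : M ⟶ N where
  app b := ModuleCat.ofHom (φ b)
  naturality b b' p := ModuleCat.hom_ext (LinearMap.ext fun x => h b b' p x)

theorem homOfLin_app {M N : LMod k (LinearQuiver m)} (φ : ∀ b, M.obj b →ₗ[k] N.obj b)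
    (h : ∀ (b b' : Paths (LinearQuiver m)) (p : b ⟶ b') (x : M.obj b),
      φ b' ((M.map p).hom x) = (N.map p).hom (φ b x)) (b : Paths (LinearQuiver m))
    (x : M.obj b) : ((homOfLin φ h).app b).hom x = φ b x := rfl

theorem nat_apply {M N : LMod k (LinearQuiver m)} (f : M ⟶ N) {b b' : Paths (LinearQuiver m)}
    (p : b ⟶ b') (x : M.obj b) :
    (f.app b').hom ((M.map p).hom x) = (N.map p).hom ((f.app b).hom x) :=
  congrArg (fun t => t.hom x) (f.naturality p)

theorem map_map_apply (M : LMod k (LinearQuiver m)) {b b' b'' : Paths (LinearQuiver m)}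
    (p : b ⟶ b') (q : b' ⟶ b'') (r : b ⟶ b'') (x : M.obj b) :
    (M.map q).hom ((M.map p).hom x) = (M.map r).hom x := by
  rw [← LinearMap.comp_apply, ← ModuleCat.hom_comp, ← M.map_comp, Subsingleton.elim (p ≫ q) r]

theorem map_self_apply (M : LMod k (LinearQuiver m)) {b : Paths (LinearQuiver m)} (p : b ⟶ b)
    (x : M.obj b) : (M.map p).hom x = x := by
  rw [Subsingleton.elim p (𝟙 b), M.map_id, ModuleCat.id_apply]

/-- The simple module at a vertex. -/
def simpleAt (k : Type u) [Field k] {m : ℕ} (i : Paths (LinearQuiver m)) :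
    LMod k (LinearQuiver m) :=
  simpleMod k (V := LinearQuiver m) i

/-- The value of a function in a simple module. -/
def simpleEv (i b : Paths (LinearQuiver m)) (h : i = b) : (simpleAt k i).obj b →ₗ[k] k :=
  (LinearMap.proj (φ := fun _ => k) ⟨h⟩ : (PLift (i = b) → k) →ₗ[k] k)

theorem simpleAt_ext {i b : Paths (LinearQuiver m)} {φ φ' : (simpleAt k i).obj b}
    (h : ∀ h : i = b, simpleEv i b h φ = simpleEv i b h φ') : φ = φ' :=
  funext (α := PLift (i = b)) fun h' => h h'.down

theorem exists_simpleEv_eq (i : Paths (LinearQuiver m)) (c : k) :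
    ∃ φ : (simpleAt k i).obj i, simpleEv i i rfl φ = c :=
  ⟨fun _ => c, rfl⟩

theorem simpleAt_map_eq_zero {i b b' : Paths (LinearQuiver m)} (p : b ⟶ b') (h : b ≠ b')
    (φ : (simpleAt k i).obj b) : ((simpleAt k i).map p).hom φ = 0 :=
  funext (α := PLift (i = b')) fun h' => by
    change simpleMap (V := LinearQuiver m) (j := b) (j' := b') k i p φ h' = 0
    exact dif_neg fun hp => h (Quiver.Path.eq_of_length_zero (V := LinearQuiver m) p hp)

open Classical in
/-- The homomorphism from a simple module given by an element killed by all nontrivial paths. -/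
def simpleHom {i : Paths (LinearQuiver m)} (M : LMod k (LinearQuiver m)) (x : M.obj i)
    (hx : ∀ (b : Paths (LinearQuiver m)) (p : i ⟶ b), i ≠ b → (M.map p).hom x = 0) :
    simpleAt k i ⟶ M :=
  homOfLin (fun b => if h : i = b then
    (M.map (eqToHom h)).hom ∘ₗ LinearMap.toSpanSingleton k _ x ∘ₗ simpleEv i b h else 0)
  (fun b b' p φ => by
    by_cases h : i = b
    · subst h
      by_cases h' : i = b'
      · subst h'
        rw [map_self_apply, map_self_apply]
      · rw [dif_neg h', dif_pos rfl, LinearMap.comp_apply, LinearMap.comp_apply,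
          LinearMap.toSpanSingleton_apply, map_smul, map_smul, map_map_apply _ _ p p, hx _ p h',
          smul_zero]
        rfl
    · have : φ = 0 := simpleAt_ext fun h' => absurd h' h
      subst this
      simp only [map_zero])

theorem simpleHom_apply_self {i : Paths (LinearQuiver m)} (M : LMod k (LinearQuiver m))
    (x : M.obj i)
    (hx : ∀ (b : Paths (LinearQuiver m)) (p : i ⟶ b), i ≠ b → (M.map p).hom x = 0)
    (φ : (simpleAt k i).obj i) :
    ((simpleHom M x hx).app i).hom φ = simpleEv i i rfl φ • x := by
  rw [simpleHom, homOfLin_app, dif_pos rfl, LinearMap.comp_apply, LinearMap.comp_apply,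
    LinearMap.toSpanSingleton_apply, map_self_apply]

/-! ### Injective modules and the traces of simple modules in them -/

/-- The indecomposable injective module at a vertex. -/
def injMod (k : Type u) [Field k] {m : ℕ} (j : Paths (LinearQuiver m)) :
    LMod k (LinearQuiver m) :=
  (injBimod k (LinearQuiver m)).obj (op j)

/-- The elements of an injective module as functionals. -/
def injFun {j b : Paths (LinearQuiver m)} :
    (injMod k j).obj b ≃ₗ[k] (((b ⟶ j) →₀ k) →ₗ[k] k) :=
  LinearEquiv.refl k (Module.Dual k ((b ⟶ j) →₀ k))

/-- Evaluation of the elements of an injective module at a path. -/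
def injEv {j b : Paths (LinearQuiver m)} (p : b ⟶ j) : (injMod k j).obj b →ₗ[k] k :=
  LinearMap.applyₗ (Finsupp.single p 1) ∘ₗ injFun.toLinearMap

/-- The functional with value one on all paths. -/
def injOne (k : Type u) [Field k] {m : ℕ} (j b : Paths (LinearQuiver m)) : (injMod k j).obj b :=
  (Finsupp.linearCombination k (fun _ : b ⟶ j => (1 : k)) : ((b ⟶ j) →₀ k) →ₗ[k] k)

/-- The homomorphism of injective modules given by a path. -/
def injMap (k : Type u) [Field k] {m : ℕ} {j j' : Paths (LinearQuiver m)} (p : j' ⟶ j) :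
    injMod k j ⟶ injMod k j' :=
  (injBimod k (LinearQuiver m)).map p.op

theorem injMod_ext {j b : Paths (LinearQuiver m)} {y y' : (injMod k j).obj b}
    (h : ∀ p : b ⟶ j, injEv p y = injEv p y') : y = y' :=
  Finsupp.lhom_ext' (R := k) (N := k) (M := k) fun p => LinearMap.ext_ring (h p)

theorem injEv_map {j b b' : Paths (LinearQuiver m)} (p : b ⟶ b') (y : (injMod k j).obj b)
    (q : b' ⟶ j) : injEv q (((injMod k j).map p).hom y) = injEv (p ≫ q) y :=
  congrArg (injFun y)
    (Finsupp.mapDomain_single (f := fun r : b' ⟶ j => p ≫ r) (a := q) (b := (1 : k)))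

theorem injEv_injMap {j j' b : Paths (LinearQuiver m)} (p : j' ⟶ j) (y : (injMod k j).obj b)
    (q : b ⟶ j') : injEv q (((injMap k p).app b).hom y) = injEv (q ≫ p) y :=
  congrArg (injFun y)
    (Finsupp.mapDomain_single (f := fun r : b ⟶ j' => r ≫ p) (a := q) (b := (1 : k)))

theorem injEv_injOne {j b : Paths (LinearQuiver m)} (p : b ⟶ j) :
    injEv p (injOne k j b) = 1 :=
  (Finsupp.linearCombination_single k (1 : k) p).trans (mul_one 1)

theorem injMod_map_injOne {j b b' : Paths (LinearQuiver m)} (p : b ⟶ b') :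
    ((injMod k j).map p).hom (injOne k j b) = injOne k j b' := by
  refine injMod_ext fun q => ?_
  rw [injEv_map, injEv_injOne, injEv_injOne]

theorem injMap_injOne {j j' b : Paths (LinearQuiver m)} (p : j' ⟶ j) :
    ((injMap k p).app b).hom (injOne k j b) = injOne k j' b := by
  refine injMod_ext fun q => ?_
  rw [injEv_injMap, injEv_injOne, injEv_injOne]

/-- There is at most one path between two vertices, so injectives are at most one-dimensional at
each vertex. -/
theorem exists_smul_injOne {j b : Paths (LinearQuiver m)} (y : (injMod k j).obj b) :
    ∃ c : k, y = c • injOne k j b := by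
  by_cases h : Nonempty (b ⟶ j)
  · obtain ⟨p⟩ := h
    refine ⟨injEv p y, injMod_ext fun q => ?_⟩
    obtain rfl := Subsingleton.elim p q
    rw [map_smul, injEv_injOne, smul_eq_mul, mul_one]
  · exact ⟨0, injMod_ext fun q => absurd ⟨q⟩ h⟩

theorem injMod_eq_zero {j b : Paths (LinearQuiver m)} (h : ¬ vnum b ≤ vnum j)
    (y : (injMod k j).obj b) : y = 0 :=
  injMod_ext fun q => absurd (vnum_le q) h

/-- Since I_i vanishes at all vertices beyond i, every element at i is killed by the nontrivial
paths and so is the image of a generator of L_i. -/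
theorem trace_eq_top (i : Paths (LinearQuiver m)) :
    trace (simpleAt k i) (injMod k i) i = ⊤ := by
  refine eq_top_iff.2 fun y _ => ?_
  have hy : ∀ (b : Paths (LinearQuiver m)) (p : i ⟶ b), i ≠ b →
      ((injMod k i).map p).hom y = 0 := fun b p hb => injMod_ext fun q =>
    absurd (vnum_injective (le_antisymm (vnum_le p) (vnum_le q))) hb
  obtain ⟨φ, hφ⟩ := exists_simpleEv_eq i (1 : k)
  refine Submodule.mem_iSup_of_mem (simpleHom _ y hy) ⟨φ, ?_⟩
  rw [simpleHom_apply_self, hφ, one_smul]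

/-- Away from i the simple module vanishes. At b = i ≠ j, an image of L_i is killed by any path q
from i to j, while its value on q is the value of its transport along q on the trivial path at j. -/
theorem trace_eq_bot {i j b : Paths (LinearQuiver m)} (h : b ≠ i ∨ j ≠ i) :
    trace (simpleAt k i) (injMod k j) b = ⊥ := by
  refine iSup_eq_bot.2 fun f => ?_
  rw [LinearMap.range_eq_bot]
  refine LinearMap.ext fun φ => ?_
  by_cases hb : i = b
  · subst hb
    have hj : j ≠ i := by simpa using h
    refine injMod_ext fun q => ?_
    have h2 : ((injMod k j).map q).hom ((f.app i).hom φ) = 0 := by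
      refine (nat_apply f q φ).symm.trans ?_
      rw [simpleAt_map_eq_zero q hj.symm, map_zero]
    have h3 := injEv_map q ((f.app i).hom φ) (𝟙 j)
    rw [h2, Category.comp_id, map_zero] at h3
    rw [← h3]
    exact (map_zero _).symm
  · have : φ = 0 := simpleAt_ext fun h' => absurd h' hb
    subst this
    exact map_zero _

end Simple

/-! ### The bimodule of `G_i` is projective on the left -/

section Generators

variable {k : Type u} [Field k] {m : ℕ}

/-- The value of the bimodule `F_i I`. -/
abbrev GenQuot (k : Type u) [Field k] {m : ℕ} (i a b : Paths (LinearQuiver m)) : Type u :=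
  (injMod k b).obj a ⧸ trace (simpleAt k i) (injMod k b) a

/-- The left modules forming the bimodule representing `G_i`. -/
def genMod (k : Type u) [Field k] {m : ℕ} (i a : Paths (LinearQuiver m)) :
    LMod k (LinearQuiver m) :=
  (dualBimod (injBimod k (LinearQuiver m) ⋙ projFunctor (V := LinearQuiver m) i)).obj (op a)

/-- The right action on the bimodule representing `G_i`. -/
def genModMap (k : Type u) [Field k] {m : ℕ} (i : Paths (LinearQuiver m))
    {a a' : Paths (LinearQuiver m)} (p : a ⟶ a') : genMod k i a' ⟶ genMod k i a :=
  (dualBimod (injBimod k (LinearQuiver m) ⋙ projFunctor (V := LinearQuiver m) i)).map p.op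

/-- The elements of the bimodule representing `G_i` as functionals. -/
def genDual (i a b : Paths (LinearQuiver m)) :
    (genMod k i a).obj b ≃ₗ[k] (GenQuot k i a b →ₗ[k] k) :=
  LinearEquiv.refl k (Module.Dual k (GenQuot k i a b))

/-- The coefficient of an element of the bimodule representing `G_i`. -/
def genCoef (i a b : Paths (LinearQuiver m)) : (genMod k i a).obj b →ₗ[k] k :=
  LinearMap.applyₗ (Submodule.Quotient.mk (injOne k b a)) ∘ₗ (genDual i a b).toLinearMap

theorem genCoef_apply (i a b : Paths (LinearQuiver m)) (v : (genMod k i a).obj b) :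
    genCoef i a b v = genDual i a b v (Submodule.Quotient.mk (injOne k b a)) := rfl

/-- The class of `injOne` spans the quotient, so a functional is determined by its value there. The
coefficient is also unchanged by the left and right actions, as these match the elements `injOne`;
identities in the bimodule thus reduce to identities in k. -/
theorem genCoef_injective (i a b : Paths (LinearQuiver m)) :
    Function.Injective (genCoef (k := k) i a b) := by
  rw [← LinearMap.ker_eq_bot, LinearMap.ker_eq_bot']
  intro v hv
  refine (genDual i a b).map_eq_zero_iff.1 (LinearMap.ext fun y => ?_)
  obtain ⟨y, rfl⟩ := Submodule.Quotient.mk_surjective _ y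
  obtain ⟨c, rfl⟩ := exists_smul_injOne y
  rw [Submodule.Quotient.mk_smul, map_smul, ← genCoef_apply, hv, smul_zero]
  rfl

theorem genCoef_map (i a : Paths (LinearQuiver m)) {b b' : Paths (LinearQuiver m)} (p : b ⟶ b')
    (v : (genMod k i a).obj b) :
    genCoef i a b' (((genMod k i a).map p).hom v) = genCoef i a b v :=
  congrArg (fun y => genDual i a b v (Submodule.Quotient.mk y)) (injMap_injOne p)

theorem genCoef_genModMap (i : Paths (LinearQuiver m)) {a a' b : Paths (LinearQuiver m)}
    (p : a ⟶ a') (v : (genMod k i a').obj b) :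
    genCoef i a b (((genModMap k i p).app b).hom v) = genCoef i a' b v :=
  congrArg (fun y => genDual i a' b v (Submodule.Quotient.mk y)) (injMod_map_injOne p)

/-- The vertex of the linear quiver with a given number. -/
abbrev fvtx (i : Fin m) : Paths (LinearQuiver m) := vtx i.val i.isLt

/-- Two reasons for vanishing: either a > b and I_b is zero at a, or a = b = i and the trace is
everything. -/
theorem genCoef_eq_zero (i : Fin m) {a b : Paths (LinearQuiver m)}
    (h : ¬ sharp (alpha i) (vnum a) ≤ vnum b) (v : (genMod k (fvtx i) a).obj b) :
    genCoef (fvtx i) a b v = 0 := by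
  suffices h0 : (Submodule.Quotient.mk (injOne k b a) : GenQuot k (fvtx i) a b) = 0 by
    rw [genCoef_apply, h0, map_zero]
  by_cases hab : vnum a ≤ vnum b
  · have hai : vnum a = i.val := by
      by_contra hne
      exact h (by rwa [sharp_alpha_of_ne i (vnum_lt a) hne])
    rw [hai, sharp_alpha_self] at h
    have hbi : vnum b = vnum a := by omega
    obtain rfl : a = fvtx i := vnum_injective hai
    obtain rfl : b = fvtx i := vnum_injective hbi
    rw [Submodule.Quotient.mk_eq_zero, trace_eq_top]
    exact Submodule.mem_top
  · rw [injMod_eq_zero hab (injOne k b a), Submodule.Quotient.mk_zero]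

/-- Here a ≤ b and not a = b = i, so the trace is zero and evaluation at the path from a to b passes
to the quotient. -/
theorem exists_genCoef_eq_one (i : Fin m) {a b : Paths (LinearQuiver m)}
    (h : sharp (alpha i) (vnum a) = vnum b) :
    ∃ v : (genMod k (fvtx i) a).obj b, genCoef (fvtx i) a b v = 1 := by
  have hab : vnum a ≤ vnum b ∧ (a ≠ fvtx i ∨ b ≠ fvtx i) := by
    rw [← h]
    by_cases hai : vnum a = i.val
    · rw [hai, sharp_alpha_self] at h ⊢
      refine ⟨Nat.le_succ _, Or.inr fun hb => ?_⟩
      have : vnum b = i.val := congrArg vnum hb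
      omega
    · rw [sharp_alpha_of_ne i (vnum_lt a) hai]
      exact ⟨le_rfl, Or.inl fun ha => hai (congrArg vnum ha)⟩
  refine ⟨(genDual (fvtx i) a b).symm (Submodule.liftQ _ (injEv (lpath hab.1)) ?_), ?_⟩
  · rw [trace_eq_bot hab.2]
    exact bot_le
  · rw [genCoef_apply, LinearEquiv.apply_symm_apply]
    exact injEv_injOne _

/-- A generator of the bimodule representing `G_i`. -/
def genElt (k : Type u) [Field k] {m : ℕ} (i : Fin m) (a : Paths (LinearQuiver m))
    (h : sharp (alpha i) (vnum a) < m) : (genMod k (fvtx i) a).obj (vtx _ h) :=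
  (exists_genCoef_eq_one (k := k) i (a := a) (b := vtx _ h) rfl).choose

theorem genCoef_genElt (i : Fin m) (a : Paths (LinearQuiver m))
    (h : sharp (alpha i) (vnum a) < m) :
    genCoef (fvtx i) a (vtx _ h) (genElt k i a h) = 1 :=
  (exists_genCoef_eq_one (k := k) i (a := a) (b := vtx _ h) rfl).choose_spec

open Classical in
/-- The homomorphism from the bimodule representing `G_i` given by an element. -/
def genHom (i : Fin m) (a : Paths (LinearQuiver m)) (M : LMod k (LinearQuiver m))
    (ψ : (h : PLift (sharp (alpha i) (vnum a) < m)) → M.obj (vtx _ h.down)) :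
    genMod k (fvtx i) a ⟶ M :=
  homOfLin (fun b => if h : sharp (alpha i) (vnum a) ≤ vnum b then
    (M.map (lpath (a := vtx _ (h.trans_lt (vnum_lt b))) h)).hom ∘ₗ
      LinearMap.toSpanSingleton k _ (ψ ⟨h.trans_lt (vnum_lt b)⟩) ∘ₗ genCoef (fvtx i) a b else 0)
  (fun b b' p v => by
    by_cases h : sharp (alpha i) (vnum a) ≤ vnum b
    · rw [dif_pos h, dif_pos (h.trans (vnum_le p)), LinearMap.comp_apply, LinearMap.comp_apply,
        LinearMap.comp_apply, LinearMap.comp_apply, genCoef_map, map_map_apply]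
    · rw [dif_neg h, LinearMap.zero_apply, map_zero]
      split_ifs
      · rw [LinearMap.comp_apply, LinearMap.comp_apply, genCoef_map, genCoef_eq_zero i h,
          map_zero, map_zero]
      · rfl)

theorem genHom_genElt (i : Fin m) (a : Paths (LinearQuiver m)) (M : LMod k (LinearQuiver m))
    (ψ : (h : PLift (sharp (alpha i) (vnum a) < m)) → M.obj (vtx _ h.down))
    (h : sharp (alpha i) (vnum a) < m) :
    ((genHom i a M ψ).app (vtx _ h)).hom (genElt k i a h) = ψ ⟨h⟩ := by
  rw [genHom, homOfLin_app, dif_pos le_rfl, LinearMap.comp_apply, LinearMap.comp_apply,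
    genCoef_genElt, LinearMap.toSpanSingleton_apply, one_smul, map_self_apply]

/-- The module is generated by `genElt`: each element is its coefficient times the transport of
`genElt`, or zero where no transport exists. -/
theorem genMod_hom_ext (i : Fin m) (a : Paths (LinearQuiver m)) (M : LMod k (LinearQuiver m))
    {φ φ' : genMod k (fvtx i) a ⟶ M}
    (hφ : ∀ h : sharp (alpha i) (vnum a) < m, (φ.app (vtx _ h)).hom (genElt k i a h) =
      (φ'.app (vtx _ h)).hom (genElt k i a h)) : φ = φ' := by
  refine NatTrans.ext (funext fun b => ModuleCat.hom_ext (LinearMap.ext fun v => ?_))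
  by_cases h : sharp (alpha i) (vnum a) ≤ vnum b
  · have hm := h.trans_lt (vnum_lt b)
    let p : vtx _ hm ⟶ b := lpath h
    have hv : v = ((genMod k (fvtx i) a).map p).hom
        (genCoef (fvtx i) a b v • genElt k i a hm) := by
      refine genCoef_injective _ _ _ ?_
      rw [genCoef_map, map_smul, genCoef_genElt, smul_eq_mul, mul_one]
    have h1 (φ : genMod k (fvtx i) a ⟶ M) : (φ.app b).hom v =
        (M.map p).hom (genCoef (fvtx i) a b v • (φ.app _).hom (genElt k i a hm)) := by
      rw [← map_smul]
      exact (congrArg _ hv).trans (nat_apply φ p _)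
    rw [h1, h1, hφ]
  · have hv : v = 0 := by
      refine genCoef_injective _ _ _ ?_
      rw [genCoef_eq_zero i h, map_zero]
    rw [hv, map_zero, map_zero]

/-- The functor `G_i` is a restriction functor. -/
def bigGIso (i : Fin m) :
    bigG (k := k) (V := LinearQuiver m) i ≅ restr k m (sharp (alpha i)) :=
  NatIso.ofComponents (fun M => NatIso.ofComponents (fun a => LinearEquiv.toModuleIso
    { toFun (φ : genMod k (fvtx i) a ⟶ M) h := (φ.app (vtx _ h.down)).hom (genElt k i a h.down)
      invFun ψ := genHom i a M ψ
      map_add' _ _ := rfl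
      map_smul' _ _ := rfl
      left_inv φ := genMod_hom_ext i a M fun h => genHom_genElt i a M _ h
      right_inv ψ := funext fun h => genHom_genElt i a M ψ h.down })
    (fun {a a'} p => by
      refine ModuleCat.hom_ext (LinearMap.ext fun (φ : genMod k (fvtx i) a ⟶ M) =>
        funext fun ⟨(h : sharp (alpha i) (vnum a') < m)⟩ => ?_)
      have hle : sharp (alpha i) (vnum a) ≤ sharp (alpha i) (vnum a') :=
        (sharp (alpha i)).monotone (vnum_le p)
      let q : vtx _ (hle.trans_lt h) ⟶ vtx _ h := lpath hle
      change (φ.app (vtx _ h)).hom (((genModMap k (fvtx i) p).app _).hom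
        (genElt k i a' h)) = (M.map q).hom ((φ.app _).hom (genElt k i a (hle.trans_lt h)))
      refine Eq.trans ?_ (nat_apply φ q (genElt k i a (hle.trans_lt h)))
      -- The right translate of the generator at a' and the left transport of the generator at a
      -- both have coefficient 1, so they agree.
      refine congrArg (φ.app (vtx _ h)).hom (genCoef_injective _ _ _ ?_)
      rw [genCoef_genModMap, genCoef_genElt]
      exact ((genCoef_map _ _ q _).trans (genCoef_genElt i a _)).symm))
    (fun _ => rfl)

/-- The functor `G_i` on finite dimensional modules is the restriction functor of `α_i`. -/
def genIso (i : Fin m) : G k (V := LinearQuiver m) i ≅ catRestr k (alpha i) :=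
  liftIso (Functor.isoWhiskerLeft (isFD k _).ι (bigGIso i))

end Generators

/-! ### Endomorphisms of the restriction functors -/

section Endomorphisms

variable {k : Type u} [Field k] {m : ℕ}

/-- The indecomposable projective module at a vertex. -/
def projMod (k : Type u) [Field k] {m : ℕ} (j : Paths (LinearQuiver m)) :
    LMod k (LinearQuiver m) :=
  (regular k (LinearQuiver m)).obj (op j)

/-- The elements of a projective module as combinations of paths. -/
def projFun {j b : Paths (LinearQuiver m)} : (projMod k j).obj b ≃ₗ[k] ((j ⟶ b) →₀ k) :=
  LinearEquiv.refl k _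

/-- The basis element of a projective module given by a path. -/
def projElt (k : Type u) [Field k] {m : ℕ} {j b : Paths (LinearQuiver m)} (p : j ⟶ b) :
    (projMod k j).obj b :=
  projFun.symm (Finsupp.single p 1)

theorem projMod_map_projElt {j b b' : Paths (LinearQuiver m)} (p : j ⟶ b) (q : b ⟶ b') :
    ((projMod k j).map q).hom (projElt k p) = projElt k (p ≫ q) :=
  Finsupp.mapDomain_single

theorem projElt_ne_zero {j b : Paths (LinearQuiver m)} (p : j ⟶ b) : projElt k p ≠ 0 := by
  intro h
  have := projFun.symm.map_eq_zero_iff.1 h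
  exact one_ne_zero (Finsupp.single_eq_zero.1 this)

theorem exists_smul_projElt {j b : Paths (LinearQuiver m)} (p : j ⟶ b)
    (x : (projMod k j).obj b) : ∃ c : k, x = c • projElt k p := by
  refine ⟨projFun x p, projFun.injective ?_⟩
  rw [map_smul, projElt, LinearEquiv.apply_symm_apply]
  ext q
  obtain rfl := Subsingleton.elim p q
  simp

theorem projMod_subsingleton {j b : Paths (LinearQuiver m)} (h : ¬ vnum j ≤ vnum b)
    (x : (projMod k j).obj b) : x = 0 :=
  projFun.injective (by ext q; exact absurd (vnum_le q) h)

/-- The linear map from the elements of a projective module given by an element. -/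
def projLin {j : Paths (LinearQuiver m)} (M : LMod k (LinearQuiver m)) (x : M.obj j)
    (b : Paths (LinearQuiver m)) : (projMod k j).obj b →ₗ[k] M.obj b :=
  Finsupp.linearCombination k (fun p : j ⟶ b => (M.map p).hom x) ∘ₗ projFun.toLinearMap

theorem projLin_projElt {j b : Paths (LinearQuiver m)} (M : LMod k (LinearQuiver m))
    (x : M.obj j) (p : j ⟶ b) : projLin M x b (projElt k p) = (M.map p).hom x := by
  rw [projLin, projElt, LinearMap.comp_apply, LinearEquiv.coe_coe,
    LinearEquiv.apply_symm_apply, Finsupp.linearCombination_single, one_smul]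

/-- The homomorphism from a projective module given by an element. -/
def projHom {j : Paths (LinearQuiver m)} (M : LMod k (LinearQuiver m)) (x : M.obj j) :
    projMod k j ⟶ M :=
  homOfLin (projLin M x) (fun b b' q y => by
    by_cases h : vnum j ≤ vnum b
    · obtain ⟨c, rfl⟩ := exists_smul_projElt (lpath h) y
      rw [map_smul, map_smul, map_smul, map_smul, projMod_map_projElt, projLin_projElt,
        projLin_projElt, map_map_apply]
    · rw [projMod_subsingleton h y]
      simp only [map_zero])

theorem projHom_projElt {j b : Paths (LinearQuiver m)} (M : LMod k (LinearQuiver m))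
    (x : M.obj j) (p : j ⟶ b) : ((projHom M x).app b).hom (projElt k p) = (M.map p).hom x :=
  projLin_projElt M x p

theorem isFD_projMod (j : Paths (LinearQuiver m)) : isFD k _ (projMod k j) := fun b =>
  have : Finite (j ⟶ b) := finite_path (V := LinearQuiver m) j b
  inferInstanceAs (Module.Finite k ((j ⟶ b) →₀ k))

/-- The projective module as a finite dimensional module. -/
abbrev projFD (k : Type u) [Field k] {m : ℕ} (j : Paths (LinearQuiver m)) :
    FDMod k (LinearQuiver m) := ⟨projMod k j, isFD_projMod j⟩

/-! ### Natural transformations between restriction functors -/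

/-- The value of a restriction at a vertex. -/
def restrEv {g : ℕ →o ℕ} {M : LMod k (LinearQuiver m)} {b : Paths (LinearQuiver m)}
    (h : g (vnum b) < m) : ((restr k m g).obj M).obj b ≃ₗ[k] M.obj (vtx _ h) where
  toFun φ := φ ⟨h⟩
  invFun x _ := x
  map_add' _ _ := rfl
  map_smul' _ _ := rfl
  left_inv _ := rfl
  right_inv _ := rfl

theorem restr_ext {g : ℕ →o ℕ} {M : LMod k (LinearQuiver m)} {b : Paths (LinearQuiver m)}
    {φ φ' : ((restr k m g).obj M).obj b}
    (h : ∀ h : g (vnum b) < m, restrEv h φ = restrEv h φ') : φ = φ' :=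
  funext (α := PLift (g (vnum b) < m)) fun h' => h h'.down

theorem restrEv_restr_map {g : ℕ →o ℕ} {M N : LMod k (LinearQuiver m)} (η : M ⟶ N)
    {b : Paths (LinearQuiver m)} (h : g (vnum b) < m) (φ : ((restr k m g).obj M).obj b) :
    restrEv h ((((restr k m g).map η).app b).hom φ) = (η.app (vtx _ h)).hom (restrEv h φ) := rfl

theorem restrEv_map {g : ℕ →o ℕ} {M : LMod k (LinearQuiver m)} {b b' : Paths (LinearQuiver m)}
    (p : b ⟶ b') (h : g (vnum b) < m) (h' : g (vnum b') < m) (q : vtx _ h ⟶ vtx _ h')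
    (φ : ((restr k m g).obj M).obj b) :
    restrEv h' ((((restr k m g).obj M).map p).hom φ) = (M.map q).hom (restrEv h φ) := by
  rw [Subsingleton.elim q (lpath (g.monotone (vnum_le p)))]
  rfl

/-- The component of a natural transformation between restriction functors. -/
def catRestrComp {f f' : catalan (m + 1)} (t : catRestr k f ⟶ catRestr k f')
    (M : FDMod k (LinearQuiver m)) :
    (restr k m (sharp f)).obj M.obj ⟶ (restr k m (sharp f')).obj M.obj :=
  (t.app M).hom

theorem catRestrComp_naturality {f f' : catalan (m + 1)} (t : catRestr k f ⟶ catRestr k f')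
    {M N : FDMod k (LinearQuiver m)} (η : M ⟶ N) (b : Paths (LinearQuiver m))
    (φ : ((restr k m (sharp f)).obj M.obj).obj b) :
    ((catRestrComp t N).app b).hom ((((restr k m (sharp f)).map η.hom).app b).hom φ) =
      (((restr k m (sharp f')).map η.hom).app b).hom (((catRestrComp t M).app b).hom φ) :=
  congrArg (fun s => (s.hom.app b).hom φ) (t.naturality η)

/-- Yoneda: every element of R_f M at b is the image of the universal element u of R_f P at b, where
P is the projective at f♯(b). The value of R_f P at b is a line, so t multiplies u, and then
everything, by one scalar. -/
theorem exists_scalar_at {f : catalan (m + 1)} (t : catRestr k f ⟶ catRestr k f)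
    {b : Paths (LinearQuiver m)} (h : sharp f (vnum b) < m) :
    ∃ c : k, ∀ (M : FDMod k (LinearQuiver m)) (φ : ((restr k m (sharp f)).obj M.obj).obj b),
      ((catRestrComp t M).app b).hom φ = c • φ := by
  let u : ((restr k m (sharp f)).obj (projFD k (vtx _ h)).obj).obj b :=
    (restrEv h).symm (projElt k (𝟙 _))
  obtain ⟨c, hc⟩ := exists_smul_projElt (𝟙 _)
    (restrEv h (((catRestrComp t (projFD k (vtx _ h))).app b).hom u))
  refine ⟨c, fun M φ => ?_⟩
  let η : projFD k (vtx _ h) ⟶ M := ObjectProperty.homMk (projHom M.obj (restrEv h φ))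
  have hη (d : k) : restrEv h ((((restr k m (sharp f)).map η.hom).app b).hom
      ((restrEv h).symm (d • projElt k (𝟙 _)))) = d • restrEv h φ := by
    rw [restrEv_restr_map, LinearEquiv.apply_symm_apply, map_smul]
    exact congrArg _ ((projHom_projElt _ _ _).trans (map_self_apply _ _ _))
  have h1 : φ = (((restr k m (sharp f)).map η.hom).app b).hom u :=
    (restrEv h).injective (((one_smul k _).symm.trans (hη 1).symm).trans (by rw [one_smul]))
  have h2 : ((catRestrComp t (projFD k (vtx _ h))).app b).hom u =
      (restrEv h).symm (c • projElt k (𝟙 _)) := by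
    rw [← hc, LinearEquiv.symm_apply_apply]
  refine (restrEv h).injective ?_
  conv_lhs => rw [h1, catRestrComp_naturality, h2, hη]
  rw [map_smul]

/-- Naturality along p compares the two scalars on the transport of the universal element, a basis
path of a projective and hence nonzero. -/
theorem scalar_unique {f : catalan (m + 1)} (t : catRestr k f ⟶ catRestr k f)
    {b b' : Paths (LinearQuiver m)} (p : b ⟶ b') (h : sharp f (vnum b) < m)
    (h' : sharp f (vnum b') < m) {c c' : k}
    (hc : ∀ (M : FDMod k (LinearQuiver m)) (φ : ((restr k m (sharp f)).obj M.obj).obj b),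
      ((catRestrComp t M).app b).hom φ = c • φ)
    (hc' : ∀ (M : FDMod k (LinearQuiver m)) (φ : ((restr k m (sharp f)).obj M.obj).obj b'),
      ((catRestrComp t M).app b').hom φ = c' • φ) : c = c' := by
  let u : ((restr k m (sharp f)).obj (projFD k (vtx _ h)).obj).obj b :=
    (restrEv h).symm (projElt k (𝟙 _))
  have h1 := nat_apply (catRestrComp t (projFD k (vtx _ h))) p u
  rw [hc, hc', map_smul] at h1
  have h2 := congrArg (restrEv h') h1
  let q : vtx _ h ⟶ vtx _ h' := lpath ((sharp f).monotone (vnum_le p))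
  rw [map_smul, map_smul, restrEv_map p h h' q, LinearEquiv.apply_symm_apply] at h2
  have h3 : ((projMod k (vtx _ h)).map q).hom (projElt k (𝟙 _)) ≠ 0 := by
    rw [projMod_map_projElt]
    exact projElt_ne_zero _
  exact (smul_left_injective k h3 h2).symm

theorem exists_scalar {f : catalan (m + 1)} (t : catRestr k f ⟶ catRestr k f) :
    ∃ c : k, ∀ (M : FDMod k (LinearQuiver m)) (b : Paths (LinearQuiver m))
      (φ : ((restr k m (sharp f)).obj M.obj).obj b),
      ((catRestrComp t M).app b).hom φ = c • φ := by
  -- The scalar at vertex 0 serves all vertices, as each is reached from 0; where f♯(b) = m the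
  -- value is zero. If already f♯(0) = m, the functor vanishes.
  by_cases h0 : sharp f 0 < m
  · have hm : 0 < m := by omega
    obtain ⟨c, hc⟩ := exists_scalar_at t (b := vtx 0 hm) h0
    refine ⟨c, fun M b φ => ?_⟩
    by_cases h : sharp f (vnum b) < m
    · obtain ⟨c', hc'⟩ := exists_scalar_at t h
      rw [hc', scalar_unique t (lpath (a := vtx 0 hm) (Nat.zero_le _)) h0 h hc hc']
    · exact restr_ext fun h' => absurd h' h
  · refine ⟨0, fun M b φ => restr_ext fun h' => absurd h' ?_⟩
    have := (sharp f).monotone (Nat.zero_le (vnum b))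
    omega

theorem catRestr_end {f : catalan (m + 1)} (t : catRestr k f ⟶ catRestr k f) :
    t = 0 ∨ IsIso t := by
  obtain ⟨c, hc⟩ := exists_scalar t
  have ht (M) : t.app M = c • 𝟙 _ := ObjectProperty.hom_ext _ (NatTrans.ext (funext fun b =>
    ModuleCat.hom_ext (LinearMap.ext fun φ => hc M b φ)))
  rcases eq_or_ne c 0 with rfl | h0
  · refine Or.inl (NatTrans.ext (funext fun M => ?_))
    rw [ht, zero_smul]
    rfl
  · refine Or.inr (@NatIso.isIso_of_isIso_app _ _ _ _ _ _ t fun M => ⟨c⁻¹ • 𝟙 _, ?_, ?_⟩)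
    · rw [ht, Linear.smul_comp, Linear.comp_smul, smul_smul, Category.comp_id, mul_inv_cancel₀ h0,
        one_smul]
    · rw [ht, Linear.smul_comp, Linear.comp_smul, smul_smul, Category.comp_id, inv_mul_cancel₀ h0,
        one_smul]

theorem isZero_catRestr_iff (f : catalan (m + 1)) :
    IsZero (catRestr k f) ↔ f = catalanZero m := by
  rw [← sharp_zero_eq_iff]
  constructor
  · intro hz
    by_contra h0
    have h0 : sharp f 0 < m := by omega
    have hm : 0 < m := by omega
    let b : Paths (LinearQuiver m) := vtx 0 hm
    have h1 := congrArg (fun t => t.app (projFD k (vtx _ h0))) (hz.eq_of_src (𝟙 _) 0)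
    let u : ((restr k m (sharp f)).obj (projFD k (vtx _ h0)).obj).obj b :=
      (restrEv h0).symm (projElt k (𝟙 _))
    have h2 : u = 0 := congrArg (fun t => (t.hom.app b).hom u) h1
    exact projElt_ne_zero _ ((restrEv (b := b) h0).symm.map_eq_zero_iff.1 h2)
  · intro h0
    refine (IsZero.iff_id_eq_zero _).2 (NatTrans.ext (funext fun M => ObjectProperty.hom_ext _
      (NatTrans.ext (funext fun b => ModuleCat.hom_ext (LinearMap.ext fun φ => ?_)))))
    refine restr_ext (g := sharp f) fun h' => absurd h' ?_
    have := (sharp f).monotone (Nat.zero_le (vnum b))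
    omega

/-- For P the projective at f♯(j), R_f P is nonzero at j, so R_{f'} P is nonzero there; this says
that f'♯(j) is a vertex at or after f♯(j). -/
theorem sharp_le_of_iso {f f' : catalan (m + 1)} (i : catRestr k f ≅ catRestr k f') {j : ℕ}
    (h : sharp f j < m) : sharp f j ≤ sharp f' j ∧ sharp f' j < m := by
  let b : Paths (LinearQuiver m) := vtx j (lt_of_sharp_lt f h)
  let M := projFD k (vtx _ h)
  let u : ((restr k m (sharp f)).obj M.obj).obj b := (restrEv h).symm (projElt k (𝟙 _))
  by_contra hcon
  have h1 : ((catRestrComp i.hom M).app b).hom u = 0 := restr_ext fun h' =>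
    (projMod_subsingleton (fun h2 => hcon ⟨h2, h'⟩) _).trans (map_zero _).symm
  have h2 : ((catRestrComp i.inv M).app b).hom (((catRestrComp i.hom M).app b).hom u) = u :=
    congrArg (fun t => ((t.app M).hom.app b).hom u) i.hom_inv_id
  rw [h1, map_zero] at h2
  exact projElt_ne_zero _ ((restrEv (b := b) h).symm.map_eq_zero_iff.1 h2.symm)

theorem eq_of_catRestr_iso {f f' : catalan (m + 1)} (i : catRestr k f ≅ catRestr k f') :
    f = f' := by
  refine sharp_injective fun j _ => ?_
  -- Equality inside the quiver comes from both directions of the isomorphism; if neither value is a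
  -- vertex, both are m.
  have h1 := sharp_le_of_iso i (j := j)
  have h2 := sharp_le_of_iso i.symm (j := j)
  have h3 := sharp_le f j
  have h4 := sharp_le f' j
  omega

end Endomorphisms

/-! ### The restriction functors as 1-morphisms -/

section OneMorphisms

variable {k : Type u} [Field k] {m : ℕ} {X : Type v} [Category.{w} X] [Abelian X]
  (e : X ≌ FDMod k (LinearQuiver m))

/-- Transport of endofunctors along an equivalence. -/
def transport : (FDMod k (LinearQuiver m) ⥤ FDMod k (LinearQuiver m)) ≌ (X ⥤ X) :=
  e.symm.congrLeft.trans e.symm.congrRight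

/-- The restriction functor of an element of the Catalan monoid on the abelian category. -/
def restrX (f : catalan (m + 1)) : X ⥤ X := (transport e).functor.obj (catRestr k f)

/-- The transported functor `G_i` is a restriction functor. -/
def genXIso (i : Fin m) : GX (V := LinearQuiver m) e i ≅ restrX e (alpha i) :=
  (transport e).functor.mapIso (genIso i)

/-- The restriction functor of the identity is the identity. -/
def restrXOne : restrX e 1 ≅ 𝟭 X :=
  (transport e).functor.mapIso catRestrOne ≪≫ e.unitIso.symm

/-- The restriction functor of a product is the composition. -/
def restrXMul (f f' : catalan (m + 1)) : restrX e f' ⋙ restrX e f ≅ restrX e (f * f') :=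
  Functor.isoWhiskerLeft (e.functor ⋙ catRestr k f')
    (Functor.isoWhiskerRight e.counitIso (catRestr k f ⋙ e.inverse)) ≪≫
  (transport e).functor.mapIso (catRestrMul f f')

theorem nonempty_word_iso (l : List (Fin m)) :
    Nonempty (word (V := LinearQuiver m) e l ≅ restrX e (l.map alpha).prod) := by
  induction l with
  | nil => exact ⟨(restrXOne e).symm⟩
  | cons i l ih =>
    obtain ⟨α⟩ := ih
    exact ⟨Functor.isoWhiskerRight α _ ≪≫ Functor.isoWhiskerLeft _ (genXIso e i) ≪≫
      restrXMul e (alpha i) _⟩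

theorem isOneMor_restrX (f : catalan (m + 1)) : IsOneMor e (restrX e f) := by
  obtain ⟨l, rfl⟩ := exists_alpha_word f
  exact .summand l (Retract.ofIso (nonempty_word_iso e l).some.symm)

theorem restrX_end {f : catalan (m + 1)} (t : restrX e f ⟶ restrX e f) : t = 0 ∨ IsIso t := by
  obtain ⟨t, rfl⟩ := (transport e).functor.map_surjective t
  rcases catRestr_end t with rfl | h
  · exact Or.inl (Functor.map_zero _ _ _)
  · exact Or.inr (@Functor.map_isIso _ _ _ _ _ _ (transport e).functor t h)

theorem isZero_restrX_iff (f : catalan (m + 1)) : IsZero (restrX e f) ↔ f = catalanZero m := by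
  rw [← isZero_catRestr_iff (k := k)]
  constructor
  · intro h
    rw [IsZero.iff_id_eq_zero] at h ⊢
    refine (transport e).functor.map_injective ?_
    rw [CategoryTheory.Functor.map_id, Functor.map_zero]
    exact h
  · intro h
    exact Functor.map_isZero _ h

theorem eq_of_restrX_iso {f f' : catalan (m + 1)} (i : restrX e f ≅ restrX e f') : f = f' :=
  eq_of_catRestr_iso ((transport e).functor.preimageIso i)

/-- The 1-morphism of an element of the Catalan monoid. -/
def restrG (f : catalan (m + 1)) : GCat e := ⟨restrX e f, isOneMor_restrX e f⟩

theorem isZero_gcat_iff (F : GCat e) : IsZero F ↔ IsZero F.obj := by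
  rw [IsZero.iff_id_eq_zero, IsZero.iff_id_eq_zero]
  exact ⟨fun h => congrArg (fun t => t.hom) h, fun h => ObjectProperty.hom_ext _ h⟩

theorem isZero_restrG_iff (f : catalan (m + 1)) : IsZero (restrG e f) ↔ f = catalanZero m :=
  (isZero_gcat_iff e _).trans (isZero_restrX_iff e f)

theorem restrG_end {f : catalan (m + 1)} (t : restrG e f ⟶ restrG e f) : t = 0 ∨ IsIso t := by
  rcases restrX_end e t.hom with h | h
  · exact Or.inl (ObjectProperty.hom_ext _ h)
  · have : IsIso ((IsOneMor e).ι.map t) := h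
    exact Or.inr (isIso_of_reflects_iso t (IsOneMor e).ι)

theorem eq_of_restrG_iso {f f' : catalan (m + 1)} (i : restrG e f ≅ restrG e f') : f = f' :=
  eq_of_restrX_iso e ((IsOneMor e).ι.mapIso i)

/-- The idempotent of R_f defined by the retract is zero or invertible: the retract is then zero,
hence the functor of the zero element, or all of R_f. -/
theorem retract_restrX {F : X ⥤ X} {f : catalan (m + 1)} (r : Retract F (restrX e f)) :
    ∃ f', Nonempty (F ≅ restrX e f') := by
  rcases restrX_end e (r.r ≫ r.i) with h | h
  · refine ⟨catalanZero m, ⟨IsZero.iso ?_ ((isZero_restrX_iff e _).2 rfl)⟩⟩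
    rw [IsZero.iff_id_eq_zero]
    have : 𝟙 F = r.i ≫ (r.r ≫ r.i) ≫ r.r := by simp
    rw [this, h, zero_comp, comp_zero]
  · refine ⟨f, ⟨⟨r.i, r.r, r.retract, ?_⟩⟩⟩
    rw [← cancel_epi (r.r ≫ r.i)]
    simp

/-- Every 1-morphism is a finite direct sum of restriction functors. -/
theorem gcat_induction {P : GCat e → Prop} (hiso : ∀ {F F' : GCat e}, (F ≅ F') → P F → P F')
    (hrestr : ∀ f, P (restrG e f)) (hsum : ∀ F F' : GCat e, P F → P F' → P (F ⊞ F'))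
    (F : GCat e) : P F := by
  obtain ⟨F, hF⟩ := F
  induction hF with
  | @summand F l r =>
    obtain ⟨f', ⟨i⟩⟩ := retract_restrX e (r.trans (Retract.ofIso (nonempty_word_iso e l).some))
    exact hiso ((IsOneMor e).isoMk i.symm) (hrestr f')
  | @zero F h =>
    exact hiso ((IsOneMor e).isoMk (IsZero.iso ((isZero_restrX_iff e _).2 rfl) h))
      (hrestr (catalanZero m))
  | @sum F F₁ F₂ h₁ h₂ i ih₁ ih₂ =>
    have := preservesBinaryBiproducts_of_preservesBiproducts (IsOneMor e).ι
    refine hiso ((IsOneMor e).isoMk ?_) (hsum ⟨F₁, h₁⟩ ⟨F₂, h₂⟩ ih₁ ih₂)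
    exact (IsOneMor e).ι.mapBiprod ⟨F₁, h₁⟩ ⟨F₂, h₂⟩ ≪≫ i.symm

theorem restrG_indecomposable_or_isZero (f : catalan (m + 1)) :
    Indecomposable (restrG e f) ∨ IsZero (restrG e f) := by
  by_cases hz : IsZero (restrG e f)
  · exact Or.inr hz
  · refine Or.inl ⟨hz, fun Y Z i => ?_⟩
    -- The projection of R_f onto the summand Y: if it is zero, then Y is zero; if it is invertible,
    -- the complementary projection, whose composite with it vanishes, is zero and so is Z.
    rcases restrG_end e (i.hom ≫ biprod.fst ≫ biprod.inl ≫ i.inv) with h | h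
    · left
      rw [IsZero.iff_id_eq_zero]
      have : 𝟙 Y = biprod.inl ≫ i.inv ≫ (i.hom ≫ biprod.fst ≫ biprod.inl ≫ i.inv) ≫ i.hom ≫
        biprod.fst := by simp
      rw [this, h]
      simp
    · right
      rw [IsZero.iff_id_eq_zero]
      have : biprod.snd ≫ biprod.inr ≫ i.inv = (0 : Y ⊞ Z ⟶ _) := by
        rw [← cancel_epi i.hom,
          ← cancel_mono (i.hom ≫ biprod.fst ≫ biprod.inl ≫ i.inv)]
        simp
      have h2 : 𝟙 Z = biprod.inr ≫ ((biprod.snd : Y ⊞ Z ⟶ Z) ≫ biprod.inr ≫ i.inv) ≫ i.hom ≫ biprod.snd := by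
        simp
      rw [h2, this]
      simp

/-- Induction over the construction of 1-morphisms replaces a Krull-Schmidt argument: an
indecomposable direct sum has a zero summand and is isomorphic to the other one. -/
theorem exists_restrG_iso {F : GCat e} (hF : Indecomposable F ∨ IsZero F) :
    ∃ f, Nonempty (F ≅ restrG e f) := by
  by_cases hz : IsZero F
  · exact ⟨catalanZero m, ⟨hz.iso ((isZero_restrG_iff e _).2 rfl)⟩⟩
  · have hF := hF.resolve_right hz
    have key : ∀ F : GCat e, Indecomposable F → ∃ f, Nonempty (F ≅ restrG e f) := by
      refine gcat_induction e ?_ ?_ ?_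
      · intro F F' i ih hF'
        obtain ⟨f, ⟨j⟩⟩ := ih ⟨fun h => hF'.1 (h.of_iso i.symm),
          fun Y Z j => hF'.2 Y Z (i.symm ≪≫ j)⟩
        exact ⟨f, ⟨i.symm ≪≫ j⟩⟩
      · exact fun f _ => ⟨f, ⟨Iso.refl _⟩⟩
      · intro F F' ih ih' h
        rcases h.2 F F' (Iso.refl _) with hz | hz
        · have i : F ⊞ F' ≅ F' := (isoZeroBiprod hz).symm
          obtain ⟨f, ⟨j⟩⟩ := ih' ⟨fun h' => h.1 (h'.of_iso i), fun Y Z j => h.2 Y Z (i ≪≫ j)⟩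
          exact ⟨f, ⟨i ≪≫ j⟩⟩
        · have i : F ⊞ F' ≅ F := (isoBiprodZero hz).symm
          obtain ⟨f, ⟨j⟩⟩ := ih ⟨fun h' => h.1 (h'.of_iso i), fun Y Z j => h.2 Y Z (i ≪≫ j)⟩
          exact ⟨f, ⟨i ≪≫ j⟩⟩
    exact key F hF

end OneMorphisms

/-! ### Multiplicities in additive categories -/

section Multiplicity

variable {C : Type v} [Category.{w} C] [Preadditive C]

/-- The morphisms to `T` whose compositions with all morphisms from `T` vanish. -/
def radHom (T F : C) : Submodule (End T) (F ⟶ T) where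
  carrier := {ψ | ∀ φ : T ⟶ F, φ ≫ ψ = 0}
  add_mem' h h' φ := by rw [Preadditive.comp_add, h φ, h' φ, add_zero]
  zero_mem' φ := comp_zero
  smul_mem' r ψ h φ := by
    change φ ≫ ψ ≫ r = 0
    rw [← Category.assoc, h φ, zero_comp]

theorem mem_radHom {T F : C} {ψ : F ⟶ T} : ψ ∈ radHom T F ↔ ∀ φ : T ⟶ F, φ ≫ ψ = 0 := Iff.rfl

/-- The multiplicity of `T` as a direct summand of `F`. -/
def mult (T F : C) : ℕ∞ := Module.length (End T) ((F ⟶ T) ⧸ radHom T F)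

theorem mult_congr (T : C) {F F' : C} (i : F ≅ F') : mult T F = mult T F' := by
  let l : (F ⟶ T) ≃ₗ[End T] (F' ⟶ T) :=
    { toFun ψ := i.inv ≫ ψ
      invFun ψ := i.hom ≫ ψ
      map_add' _ _ := Preadditive.comp_add _ _ _ _ _ _
      map_smul' _ _ := (Category.assoc _ _ _).symm
      left_inv _ := by simp
      right_inv _ := by simp }
  refine (Submodule.Quotient.equiv (radHom T F) (radHom T F') l ?_).length_eq
  ext ψ
  rw [Submodule.mem_map]
  constructor
  · rintro ⟨ψ, h, rfl⟩ φ
    change φ ≫ i.inv ≫ ψ = 0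
    rw [← Category.assoc]
    exact h _
  · intro h
    refine ⟨i.hom ≫ ψ, fun φ => ?_, l.right_inv ψ⟩
    rw [← Category.assoc]
    exact h _

/-- Both the module of morphisms to T and its submodule `radHom` split over a direct sum. -/
theorem mult_biprod [HasBinaryBiproducts C] (T F F' : C) :
    mult T (F ⊞ F') = mult T F + mult T F' := by
  let l : (F ⊞ F' ⟶ T) →ₗ[End T] ((F ⟶ T) ⧸ radHom T F) × ((F' ⟶ T) ⧸ radHom T F') :=
    { toFun ψ := (Submodule.Quotient.mk (biprod.inl ≫ ψ), Submodule.Quotient.mk (biprod.inr ≫ ψ))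
      map_add' ψ ψ' := by
        rw [Preadditive.comp_add, Preadditive.comp_add]
        rfl
      map_smul' r ψ := by
        have h (G : C) (φ : G ⟶ F ⊞ F') : φ ≫ (r • ψ) = r • (φ ≫ ψ) :=
          (Category.assoc φ ψ r).symm
        rw [h, h]
        rfl }
  have hsurj : Function.Surjective l := by
    rintro ⟨a, b⟩
    obtain ⟨a, rfl⟩ := Submodule.Quotient.mk_surjective _ a
    obtain ⟨b, rfl⟩ := Submodule.Quotient.mk_surjective _ b
    exact ⟨biprod.desc a b, by simp [l]⟩
  have hker : LinearMap.ker l = radHom T (F ⊞ F') := by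
    ext ψ
    rw [LinearMap.mem_ker, mem_radHom]
    change (Submodule.Quotient.mk _, Submodule.Quotient.mk _) = (0, 0) ↔ _
    rw [Prod.mk.injEq, Submodule.Quotient.mk_eq_zero, Submodule.Quotient.mk_eq_zero]
    constructor
    · rintro ⟨h, h'⟩ φ
      have : φ ≫ ψ = (φ ≫ biprod.fst) ≫ biprod.inl ≫ ψ + (φ ≫ biprod.snd) ≫ biprod.inr ≫ ψ := by
        conv_lhs => rw [← Category.id_comp ψ, ← biprod.total]
        simp only [Preadditive.add_comp, Preadditive.comp_add, Category.assoc]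
      rw [this, h, h', add_zero]
    · intro h
      exact ⟨fun φ => by rw [← Category.assoc]; exact h _,
        fun φ => by rw [← Category.assoc]; exact h _⟩
  rw [mult, ← hker, (l.quotKerEquivOfSurjective hsurj).length_eq, Module.length_prod]
  rfl

/-- The submodule `radHom T T` is zero, as one may compose with the identity, and the regular module
of a division ring has length one. -/
theorem mult_self {T : C} (hT : ¬ IsZero T) (h : ∀ t : T ⟶ T, t = 0 ∨ IsIso t) :
    mult T T = 1 := by
  have hbot : radHom T T = ⊥ := by
    rw [Submodule.eq_bot_iff]
    intro ψ hψ
    have := hψ (𝟙 T)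
    rwa [Category.id_comp] at this
  rw [mult, (Submodule.quotEquivOfEqBot _ hbot).length_eq, Module.length_eq_one_iff,
    isSimpleModule_iff_toSpanSingleton_surjective]
  refine ⟨⟨𝟙 T, 0, fun h => hT ((IsZero.iff_id_eq_zero T).2 h)⟩, fun ψ hψ χ => ?_⟩
  have := (h ψ).resolve_left hψ
  refine ⟨inv ψ ≫ χ, ?_⟩
  change ψ ≫ inv ψ ≫ χ = χ
  simp

theorem mult_eq_zero {T F : C} (h : ∀ (φ : T ⟶ F) (ψ : F ⟶ T), φ ≫ ψ = 0) : mult T F = 0 := by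
  have htop : radHom T F = ⊤ := eq_top_iff.2 fun ψ _ φ => h φ ψ
  rw [mult, Module.length_eq_zero_iff]
  exact Submodule.Quotient.subsingleton_iff.2 htop

end Multiplicity

/-! ### The Grothendieck ring of the 1-morphisms -/

section ContractedLift

variable {m : ℕ} {R : Type v} [Ring R]

/-- The homomorphism from the contracted monoid ring given by a monoid homomorphism
annihilating the zero element. -/
def contractedLift (φ : catalan (m + 1) →* R) (h : φ (catalanZero m) = 0) :
    ContractedRing m →+* R :=
  RingCon.lift _ ((MonoidAlgebra.lift ℤ R _ φ : MonoidAlgebra ℤ (catalan (m + 1)) →ₐ[ℤ] R) :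
    MonoidAlgebra ℤ (catalan (m + 1)) →+* R) fun {x y} hxy => by
      have hle : TwoSidedIdeal.span {MonoidAlgebra.of ℤ (catalan (m + 1)) (catalanZero m)} ≤
          TwoSidedIdeal.ker ((MonoidAlgebra.lift ℤ R _ φ :
            MonoidAlgebra ℤ (catalan (m + 1)) →ₐ[ℤ] R) :
            MonoidAlgebra ℤ (catalan (m + 1)) →+* R) := by
        rw [TwoSidedIdeal.span_le, Set.singleton_subset_iff, SetLike.mem_coe,
          TwoSidedIdeal.mem_ker]
        exact (MonoidAlgebra.lift_of φ _).trans h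
      exact TwoSidedIdeal.ringCon_le_iff.1 hle hxy

theorem contractedLift_mk' (φ : catalan (m + 1) →* R) (h : φ (catalanZero m) = 0)
    (y : MonoidAlgebra ℤ (catalan (m + 1))) :
    contractedLift φ h (RingCon.mk' _ y) = MonoidAlgebra.lift ℤ R _ φ y := rfl

theorem contractedLift_mk (φ : catalan (m + 1) →* R) (h : φ (catalanZero m) = 0)
    (f : catalan (m + 1)) : contractedLift φ h (ContractedRing.mk f) = φ f :=
  MonoidAlgebra.lift_of φ f

theorem contractedRing_mk'_eq_zero {y : MonoidAlgebra ℤ (catalan (m + 1))}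
    (h : ∀ f, f ≠ catalanZero m → y.coeff f = 0) :
    (RingCon.mk' _ y : ContractedRing m) = 0 := by
  have hy : y = y.coeff (catalanZero m) • MonoidAlgebra.of ℤ _ (catalanZero m) := by
    ext f
    rw [MonoidAlgebra.coeff_smul, Finsupp.smul_apply, MonoidAlgebra.of_apply,
      MonoidAlgebra.coeff_single]
    rcases eq_or_ne f (catalanZero m) with rfl | hf
    · simp
    · rw [h f hf, Finsupp.single_eq_of_ne hf, smul_zero]
  have h0 : (RingCon.mk' _ (MonoidAlgebra.of ℤ _ (catalanZero m)) : ContractedRing m) = 0 :=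
    (RingCon.eq _).2 (TwoSidedIdeal.subset_span (Set.mem_singleton _))
  rw [hy, map_zsmul, h0, smul_zero]

end ContractedLift

/-! ### Linear independence of the classes of restriction functors -/

section GrothendieckRing

variable {k : Type u} [Field k] {m : ℕ} {X : Type v} [Category.{w} X] [Abelian X]
  (e : X ≌ FDMod k (LinearQuiver m))

variable {e} in
theorem GrG.mk_congr {F F' : GCat e} (i : F ≅ F') : GrG.mk F = GrG.mk F' := by
  rw [GrG.mk, GrG.mk, cls_eq i]

variable {e} in
theorem GrG.mk_biprod (F F' : GCat e) : GrG.mk (F ⊞ F') = GrG.mk F + GrG.mk F' := by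
  rw [GrG.mk, GrG.mk, GrG.mk, ← map_add]
  refine (RingCon.eq _).2 ((TwoSidedIdeal.rel_iff _ _ _).2 ?_)
  rw [splitIdeal, TwoSidedIdeal.mem_mk', ← sub_sub]
  exact AddSubgroup.subset_closure ⟨F, F', rfl⟩

variable {e} in
-- For a zero object F ⊞ F ≅ F, so the class equals its double.
theorem GrG.mk_eq_zero {F : GCat e} (h : IsZero F) : GrG.mk F = 0 := by
  have := GrG.mk_biprod F F
  rwa [← GrG.mk_congr (isoZeroBiprod h), left_eq_add] at this

/-- The isomorphism classes of the restriction functors. -/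
def restrCls : catalan (m + 1) →* IsoCl (GCat e) where
  toFun f := cls (restrG e f)
  map_one' := cls_eq ((IsOneMor e).isoMk (restrXOne e))
  map_mul' f f' := cls_eq ((IsOneMor e).isoMk (restrXMul e f f').symm)

theorem restrCls_injective : Function.Injective (restrCls e) := fun _ _ h =>
  eq_of_restrG_iso e (Quotient.exact h).some

theorem range_restrCls : (MonoidHom.mrange (restrCls e) : Set _) = indecClasses e := by
  ext x
  constructor
  · rintro ⟨f, rfl⟩
    exact ⟨restrG e f, rfl, restrG_indecomposable_or_isZero e f⟩
  · rintro ⟨F, rfl, hF⟩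
    obtain ⟨f, ⟨i⟩⟩ := exists_restrG_iso e hF
    exact ⟨f, (cls_eq i).symm⟩

open Classical in
theorem mult_restrG {f : catalan (m + 1)} (hf : f ≠ catalanZero m) (f' : catalan (m + 1)) :
    mult (restrG e f) (restrG e f') = if f = f' then 1 else 0 := by
  split_ifs with hff
  · subst hff
    exact mult_self (fun h => hf ((isZero_restrG_iff e f).1 h)) (restrG_end e)
  · refine mult_eq_zero fun φ ψ => ?_
    -- A nonzero φ ≫ ψ is invertible. Then ψ ≫ φ cannot vanish, as (φ ≫ ψ)² would, so it is
    -- invertible too and φ is an isomorphism of restriction functors of different elements.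
    by_contra h0
    have h1 := (restrG_end e (φ ≫ ψ)).resolve_left h0
    rcases restrG_end e (ψ ≫ φ) with h2 | h2
    · apply h0
      rw [← cancel_mono (φ ≫ ψ), Category.assoc, ← Category.assoc ψ, h2]
      simp
    · have : IsSplitMono φ := ⟨⟨⟨ψ ≫ inv (φ ≫ ψ), by rw [← Category.assoc, IsIso.hom_inv_id]⟩⟩⟩
      have : IsSplitEpi φ := ⟨⟨⟨inv (ψ ≫ φ) ≫ ψ, by rw [Category.assoc, IsIso.inv_hom_id]⟩⟩⟩
      have : IsIso φ := isIso_of_mono_of_isSplitEpi φ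
      exact hff (eq_of_restrG_iso e (asIso φ))

/-- Finiteness is needed because `ENat.toNat` is additive only on finite values. -/
theorem mult_ne_top {f : catalan (m + 1)} (hf : f ≠ catalanZero m) (F : GCat e) :
    mult (restrG e f) F ≠ ⊤ := by
  refine gcat_induction e (P := fun F => mult (restrG e f) F ≠ ⊤) ?_ ?_ ?_ F
  · intro F F' i hF
    rwa [← mult_congr _ i]
  · intro f'
    rw [mult_restrG e hf]
    split_ifs <;> simp
  · intro F F' hF hF'
    rw [mult_biprod]
    exact WithTop.add_ne_top.2 ⟨hF, hF'⟩

/-- The multiplicity of a restriction functor as an additive function. -/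
def multHom (f : catalan (m + 1)) : FreeAbelianGroup (IsoCl (GCat e)) →+ ℤ :=
  FreeAbelianGroup.lift (Quotient.lift (fun F => ((mult (restrG e f) F).toNat : ℤ))
    fun F F' ⟨i⟩ => by rw [mult_congr _ i])

theorem multHom_of (f : catalan (m + 1)) (F : GCat e) :
    multHom e f (FreeAbelianGroup.of (cls F)) = ((mult (restrG e f) F).toNat : ℤ) :=
  FreeAbelianGroup.lift_apply_of _ _

theorem multHom_splitRel {f : catalan (m + 1)} (hf : f ≠ catalanZero m)
    {x : FreeAbelianGroup (IsoCl (GCat e))} (hx : x ∈ splitRel (GCat e)) : multHom e f x = 0 := by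
  have hle : splitRel (GCat e) ≤ (multHom e f).ker := by
    refine (AddSubgroup.closure_le _).2 ?_
    rintro _ ⟨F, F', rfl⟩
    rw [SetLike.mem_coe, AddMonoidHom.mem_ker, map_sub, map_sub, multHom_of, multHom_of,
      multHom_of, mult_biprod, ENat.toNat_add (mult_ne_top e hf F) (mult_ne_top e hf F')]
    push_cast
    ring
  exact hle hx

/-- The monoid homomorphism from the Catalan monoid to the Grothendieck ring. -/
def restrGr : catalan (m + 1) →* GrG e :=
  ((splitIdeal e).ringCon.mk' : _ →* GrG e).comp
    (FreeAbelianGroup.ofMulHom.comp (restrCls e))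

/-- The homomorphism from the contracted monoid ring to the Grothendieck ring. -/
def contractedToGrG : ContractedRing m →+* GrG e :=
  contractedLift (restrGr e) (GrG.mk_eq_zero ((isZero_restrG_iff e _).2 rfl))

theorem contractedToGrG_mk (f : catalan (m + 1)) :
    contractedToGrG e (ContractedRing.mk f) = GrG.mk (restrG e f) :=
  contractedLift_mk _ _ f

theorem contractedToGrG_surjective : Function.Surjective (contractedToGrG e) := by
  rw [← RingHom.range_eq_top, eq_top_iff]
  have key : ∀ F : GCat e, GrG.mk F ∈ (contractedToGrG e).range := by
    refine gcat_induction e ?_ ?_ ?_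
    · intro F F' i h
      rwa [← GrG.mk_congr i]
    · exact fun f => ⟨_, contractedToGrG_mk e f⟩
    · intro F F' h h'
      rw [GrG.mk_biprod]
      exact add_mem h h'
  rintro x -
  obtain ⟨x, rfl⟩ := RingCon.mk'_surjective _ x
  induction x using FreeAbelianGroup.induction_on with
  | zero => exact zero_mem _
  | neg x h =>
    rw [map_neg]
    exact neg_mem h
  | add x y hx hy =>
    rw [map_add]
    exact add_mem hx hy
  | of x =>
    induction x using Quotient.inductionOn with
    | _ F => exact key F

theorem multHom_lift {f : catalan (m + 1)} (hf : f ≠ catalanZero m)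
    (y : MonoidAlgebra ℤ (catalan (m + 1))) :
    multHom e f (MonoidAlgebra.lift ℤ (FreeAbelianGroup (IsoCl (GCat e))) _
      (FreeAbelianGroup.ofMulHom.comp (restrCls e)) y) = y.coeff f := by
  induction y using MonoidAlgebra.induction_linear with
  | zero => simp
  | add x y hx hy => rw [map_add, map_add, hx, hy, MonoidAlgebra.coeff_add, Finsupp.add_apply]
  | single f' n =>
    rw [MonoidAlgebra.lift_single, map_zsmul, MonoidAlgebra.coeff_single]
    change n • multHom e f (FreeAbelianGroup.of (cls (restrG e f'))) = _
    rw [multHom_of, mult_restrG e hf]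
    rcases eq_or_ne f f' with rfl | h
    · simp
    · rw [if_neg h, Finsupp.single_eq_of_ne h]
      simp

/-- If y maps to zero, its image in the free abelian group lies in the split relations, on which the
multiplicity of each nonzero R_f vanishes. That multiplicity reads off the coefficient of y at f, so
only the zero element survives in y. -/
theorem contractedToGrG_injective : Function.Injective (contractedToGrG e) := by
  refine (injective_iff_map_eq_zero _).2 fun x hx => ?_
  obtain ⟨y, rfl⟩ := RingCon.mk'_surjective _ x
  refine contractedRing_mk'_eq_zero fun f hf => ?_
  rw [← multHom_lift e hf]
  refine multHom_splitRel e hf ?_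
  have h1 : contractedToGrG e (RingCon.mk' _ y) = (splitIdeal e).ringCon.mk'
      (MonoidAlgebra.lift ℤ (FreeAbelianGroup (IsoCl (GCat e))) _
      (FreeAbelianGroup.ofMulHom.comp (restrCls e)) y) := by
    refine (contractedLift_mk' (restrGr e) _ y).trans ?_
    clear hx
    induction y using MonoidAlgebra.induction_linear with
    | zero => simp
    | add x y hx hy => rw [map_add, map_add, map_add, hx, hy]
    | single f' n =>
      rw [MonoidAlgebra.lift_single, MonoidAlgebra.lift_single, map_zsmul]
      rfl
  rw [h1] at hx
  have h2 := (RingCon.eq _).1 (hx.trans (map_zero ((splitIdeal e).ringCon.mk')).symm)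
  have h3 := (TwoSidedIdeal.rel_iff _ _ _).1 h2
  rwa [sub_zero, splitIdeal, TwoSidedIdeal.mem_mk'] at h3

/-- The Grothendieck ring is the contracted monoid ring. -/
def grEquiv : ContractedRing m ≃+* GrG e :=
  RingEquiv.ofBijective (contractedToGrG e)
    ⟨contractedToGrG_injective e, contractedToGrG_surjective e⟩

theorem grEquiv_symm_mk (f : catalan (m + 1)) :
    (grEquiv e).symm (GrG.mk (restrG e f)) = ContractedRing.mk f :=
  (grEquiv e).symm_apply_eq.2 (contractedToGrG_mk e f).symm

end GrothendieckRing

/-! ### Dimension vectors -/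

section Exactness

variable {k : Type u} [Field k] {m : ℕ}

/-- Elements at b correspond to morphisms from the projective at b, so a categorical monomorphism is
pointwise injective. -/
theorem app_injective_of_mono {M N : FDMod k (LinearQuiver m)} (η : M ⟶ N) [Mono η]
    (b : Paths (LinearQuiver m)) : Function.Injective (η.hom.app b).hom := by
  refine (injective_iff_map_eq_zero _).2 fun x hx => ?_
  let ξ : projFD k b ⟶ M := ObjectProperty.homMk (projHom M.obj x)
  have h : ξ ≫ η = 0 := by
    refine ObjectProperty.hom_ext _ (NatTrans.ext (funext fun a => ModuleCat.hom_ext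
      (LinearMap.ext fun y => ?_)))
    change (η.hom.app a).hom (((projHom M.obj x).app a).hom y) = 0
    by_cases hba : vnum b ≤ vnum a
    · obtain ⟨c, rfl⟩ := exists_smul_projElt (lpath hba) y
      rw [map_smul, projHom_projElt, map_smul, nat_apply, hx, map_zero, smul_zero]
    · rw [projMod_subsingleton hba y, map_zero, map_zero]
  have h' : ξ = 0 := by rw [← cancel_mono η, h, zero_comp]
  have h2 : ((projHom M.obj x).app b).hom (projElt k (𝟙 b)) = 0 :=
    congrArg (fun t => (t.hom.app b).hom (projElt k (𝟙 b))) h'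
  rwa [projHom_projElt, map_self_apply] at h2

theorem mono_of_app_injective {M N : FDMod k (LinearQuiver m)} (η : M ⟶ N)
    (h : ∀ b, Function.Injective (η.hom.app b).hom) : Mono η where
  right_cancellation {Z} ξ ξ' hξ := by
    refine ObjectProperty.hom_ext _ (NatTrans.ext (funext fun a => ModuleCat.hom_ext
      (LinearMap.ext fun y => h a ?_)))
    exact congrArg (fun t => (t.hom.app a).hom y) hξ

open Classical in
/-- The homomorphism to an injective module given by a linear functional. -/
def injHom {b : Paths (LinearQuiver m)} (N : LMod k (LinearQuiver m)) (ξ : N.obj b →ₗ[k] k) :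
    N ⟶ injMod k b :=
  homOfLin (fun a => if h : vnum a ≤ vnum b then
    LinearMap.toSpanSingleton k _ (injOne k b a) ∘ₗ ξ ∘ₗ (N.map (lpath h)).hom else 0)
  (fun a a' p y => by
    by_cases h : vnum a' ≤ vnum b
    · rw [dif_pos h, dif_pos ((vnum_le p).trans h), LinearMap.comp_apply, LinearMap.comp_apply,
        LinearMap.comp_apply, LinearMap.comp_apply, map_map_apply, LinearMap.toSpanSingleton_apply,
        LinearMap.toSpanSingleton_apply, map_smul, injMod_map_injOne]
    · exact (injMod_eq_zero h _).trans (injMod_eq_zero h _).symm)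

theorem injHom_apply {a b : Paths (LinearQuiver m)} (N : LMod k (LinearQuiver m))
    (ξ : N.obj b →ₗ[k] k) (p : a ⟶ b) (y : N.obj a) :
    ((injHom N ξ).app a).hom y = ξ ((N.map p).hom y) • injOne k b a := by
  rw [injHom, homOfLin_app, dif_pos (vnum_le p), LinearMap.comp_apply, LinearMap.comp_apply,
    LinearMap.toSpanSingleton_apply, Subsingleton.elim (lpath (vnum_le p)) p]

theorem isFD_injMod (j : Paths (LinearQuiver m)) : isFD k _ (injMod k j) :=
  finite_injBimod (V := LinearQuiver m) (op j)

/-- Dually, a functional at b vanishing on the image gives a morphism to the injective at b that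
kills η. -/
theorem app_surjective_of_epi {M N : FDMod k (LinearQuiver m)} (η : M ⟶ N) [Epi η]
    (b : Paths (LinearQuiver m)) : Function.Surjective (η.hom.app b).hom := by
  rw [← LinearMap.range_eq_top]
  by_contra hlt
  obtain ⟨ξ, hξ0, hξ⟩ := Submodule.exists_le_ker_of_lt_top _ (lt_top_iff_ne_top.2 hlt)
  let I : FDMod k (LinearQuiver m) := ⟨injMod k b, isFD_injMod b⟩
  let θ : N ⟶ I := ObjectProperty.homMk (injHom N.obj ξ)
  have h : η ≫ θ = 0 := by
    refine ObjectProperty.hom_ext _ (NatTrans.ext (funext fun a => ModuleCat.hom_ext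
      (LinearMap.ext fun y => ?_)))
    change ((injHom N.obj ξ).app a).hom ((η.hom.app a).hom y) = 0
    by_cases hab : vnum a ≤ vnum b
    · rw [injHom_apply _ _ (lpath hab), ← nat_apply, LinearMap.mem_ker.1 (hξ ⟨_, rfl⟩), zero_smul]
    · exact injMod_eq_zero hab _
  have h' : θ = 0 := by rw [← cancel_epi η, h, comp_zero]
  refine hξ0 (LinearMap.ext fun y => ?_)
  have h2 : ((injHom N.obj ξ).app b).hom y = 0 :=
    congrArg (fun t => (t.hom.app b).hom y) h'
  rw [injHom_apply _ _ (𝟙 b), map_self_apply] at h2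
  have h3 := congrArg (injEv (𝟙 b)) h2
  rwa [map_smul, injEv_injOne, map_zero, smul_eq_mul, mul_one] at h3

/-! ### Dimension vectors and their additivity -/

/-- The dimension of a finite dimensional module at a vertex, extended by zero. -/
def dimFD (M : FDMod k (LinearQuiver m)) (j : ℕ) : ℕ :=
  Module.finrank k (((hat k m).obj M.obj).obj j)

/-- The value of an extension by zero at a vertex. -/
def hatEv (M : LMod k (LinearQuiver m)) {j : ℕ} (h : j < m) :
    ((hat k m).obj M).obj j ≃ₗ[k] M.obj (vtx j h) where
  toFun φ := φ ⟨h⟩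
  invFun x _ := x
  map_add' _ _ := rfl
  map_smul' _ _ := rfl
  left_inv _ := rfl
  right_inv _ := rfl

theorem dimFD_eq (M : FDMod k (LinearQuiver m)) {j : ℕ} (h : j < m) :
    dimFD M j = Module.finrank k (M.obj.obj (vtx j h)) :=
  (hatEv M.obj h).finrank_eq

theorem dimFD_eq_zero (M : FDMod k (LinearQuiver m)) {j : ℕ} (h : m ≤ j) : dimFD M j = 0 := by
  have : Subsingleton (((hat k m).obj M.obj).obj j) :=
    ⟨fun φ ψ => funext (α := PLift (j < m)) fun h' => absurd h'.down (not_lt.2 h)⟩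
  exact Module.finrank_zero_of_subsingleton

theorem dimFD_congr {M N : FDMod k (LinearQuiver m)} (i : M ≅ N) (j : ℕ) :
    dimFD M j = dimFD N j :=
  (((hat k m).mapIso ((isFD k _).ι.mapIso i)).app j).toLinearEquiv.finrank_eq

theorem dimFD_catRestr (f : catalan (m + 1)) (M : FDMod k (LinearQuiver m)) (j : ℕ) :
    dimFD ((catRestr k f).obj M) j = dimFD M (sharp f j) :=
  (((hatRestr (sharp f) (fun _ => lt_of_sharp_lt f)).app M.obj).app j).toLinearEquiv.finrank_eq

theorem finite_FD (M : FDMod k (LinearQuiver m)) (b : Paths (LinearQuiver m)) :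
    Module.Finite k (M.obj.obj b) := M.property b

theorem dimFD_simple {b : Paths (LinearQuiver m)} (h : isFD k _ (simpleAt k b)) (j : ℕ) :
    dimFD ⟨simpleAt k b, h⟩ j = if j = vnum b then 1 else 0 := by
  split_ifs with hj
  · subst hj
    rw [dimFD_eq _ (vnum_lt b)]
    change Module.finrank k ((simpleAt k b).obj b) = 1
    refine (LinearEquiv.ofBijective (simpleEv (k := k) b b rfl) ⟨fun φ φ' h => ?_, fun c => ?_⟩
      ).finrank_eq.trans (Module.finrank_self k)
    · exact simpleAt_ext fun _ => h
    · exact exists_simpleEv_eq _ c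
  · rcases lt_or_ge j m with hm | hm
    · rw [dimFD_eq _ hm]
      have : Subsingleton ((simpleAt k b).obj (vtx j hm)) :=
        ⟨fun φ φ' => simpleAt_ext fun h => absurd (congrArg vnum h).symm hj⟩
      exact Module.finrank_zero_of_subsingleton
    · exact dimFD_eq_zero _ hm

theorem isFD_simpleAt (b : Paths (LinearQuiver m)) : isFD k _ (simpleAt k b) := fun b' =>
  inferInstanceAs (Module.Finite k (PLift (b = b') → k))

theorem dimFD_inj (c : Fin m) (j : ℕ) :
    dimFD (inj k (V := LinearQuiver m) c) j = if j ≤ c.val then 1 else 0 := by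
  rcases lt_or_ge j m with hm | hm
  · rw [dimFD_eq _ hm]
    change Module.finrank k ((injMod k (fvtx c)).obj (vtx j hm)) = _
    split_ifs with hj
    · refine finrank_eq_one (injOne k (fvtx c) (vtx j hm)) (fun h => ?_) fun y => ?_
      · have h1 := injEv_injOne (k := k) (j := fvtx c) (b := vtx j hm) (lpath hj)
        rw [h, map_zero] at h1
        exact zero_ne_one h1
      · obtain ⟨a, ha⟩ := exists_smul_injOne y
        exact ⟨a, ha.symm⟩
    · have : Subsingleton ((injMod k (fvtx c)).obj (vtx j hm)) :=
        ⟨fun y y' => (injMod_eq_zero hj y).trans (injMod_eq_zero hj y').symm⟩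
      exact Module.finrank_zero_of_subsingleton
  · rw [dimFD_eq_zero _ hm, if_neg]
    have := c.isLt
    omega

theorem dimFD_add {M₁ M₂ M₃ : FDMod k (LinearQuiver m)} (f : M₁ ⟶ M₂) (g : M₂ ⟶ M₃)
    [Mono f] [Epi g] (w : f ≫ g = 0) (hf : IsLimit (KernelFork.ofι f w)) (j : ℕ) :
    dimFD M₂ j = dimFD M₁ j + dimFD M₃ j := by
  rcases lt_or_ge j m with hm | hm
  · rw [dimFD_eq _ hm, dimFD_eq _ hm, dimFD_eq _ hm]
    have := finite_FD M₁ (vtx j hm)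
    have := finite_FD M₂ (vtx j hm)
    have h1 := app_injective_of_mono f (vtx j hm)
    have h2 := app_surjective_of_epi g (vtx j hm)
    have h3 : LinearMap.range (f.hom.app (vtx j hm)).hom =
        LinearMap.ker (g.hom.app (vtx j hm)).hom := by
      apply le_antisymm
      · rintro _ ⟨x, rfl⟩
        exact congrArg (fun t => (t.hom.app (vtx j hm)).hom x) w
      · intro x hx
        -- An element of the pointwise kernel is a morphism from a projective; it factors through
        -- the categorical kernel f, which exhibits a preimage.
        let ξ : projFD k (vtx j hm) ⟶ M₂ := ObjectProperty.homMk (projHom M₂.obj x)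
        have h : ξ ≫ g = 0 := by
          refine ObjectProperty.hom_ext _ (NatTrans.ext (funext fun a => ModuleCat.hom_ext
            (LinearMap.ext fun y => ?_)))
          change (g.hom.app a).hom (((projHom M₂.obj x).app a).hom y) = 0
          by_cases hba : j ≤ vnum a
          · obtain ⟨c, rfl⟩ := exists_smul_projElt (lpath (a := vtx j hm) hba) y
            rw [map_smul, projHom_projElt, map_smul, nat_apply, LinearMap.mem_ker.1 hx, map_zero,
              smul_zero]
          · rw [projMod_subsingleton (j := vtx j hm) hba y, map_zero, map_zero]
        obtain ⟨l, hl⟩ := KernelFork.IsLimit.lift' hf ξ h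
        refine ⟨(l.hom.app (vtx j hm)).hom (projElt k (𝟙 _)), ?_⟩
        have h4 := congrArg (fun t => (t.hom.app (vtx j hm)).hom (projElt k (𝟙 _))) hl
        refine h4.trans ?_
        exact (projHom_projElt _ _ _).trans (map_self_apply _ _ _)
    have h4 := (g.hom.app (vtx j hm)).hom.finrank_range_add_finrank_ker
    rw [← h3, LinearMap.range_eq_top.2 h2, finrank_top, LinearMap.finrank_range_of_inj h1] at h4
    omega
  · rw [dimFD_eq_zero _ hm, dimFD_eq_zero _ hm, dimFD_eq_zero _ hm]

end Exactness

/-! ### The Grothendieck group of the abelian category -/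

section GrothendieckGroup

theorem GrAb.mk_congr {C : Type v} [Category.{w} C] [Abelian C] {A B : C} (i : A ≅ B) :
    GrAb.mk A = GrAb.mk B := by
  rw [GrAb.mk, GrAb.mk, cls_eq i]

theorem GrAb.mk_exact {C : Type v} [Category.{w} C] [Abelian C] {S : ShortComplex C}
    (hS : S.ShortExact) : GrAb.mk S.X₂ = GrAb.mk S.X₁ + GrAb.mk S.X₃ := by
  rw [GrAb.mk, GrAb.mk, GrAb.mk, ← QuotientAddGroup.mk_add, eq_comm, QuotientAddGroup.eq]
  refine AddSubgroup.subset_closure ⟨S, hS, ?_⟩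
  abel

theorem GrAb.mk_eq_zero {C : Type v} [Category.{w} C] [Abelian C] {A : C} (h : IsZero A) :
    GrAb.mk A = 0 := by
  have hS : (ShortComplex.mk (0 : A ⟶ A) (0 : A ⟶ A) comp_zero).ShortExact :=
    ShortComplex.Splitting.shortExact
      { r := 0
        s := 0
        f_r := h.eq_of_src _ _
        s_g := h.eq_of_src _ _
        id := h.eq_of_src _ _ }
  have h1 : GrAb.mk A = GrAb.mk A + GrAb.mk A := GrAb.mk_exact hS
  rwa [left_eq_add] at h1

variable {k : Type u} [Field k] {m : ℕ} {X : Type v} [Category.{w} X] [Abelian X]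
  (e : X ≌ FDMod k (LinearQuiver m))

/-- The dimension of an object at a vertex. -/
def dimX (A : X) (j : ℕ) : ℕ := dimFD (e.functor.obj A) j

theorem dimX_congr {A B : X} (i : A ≅ B) (j : ℕ) : dimX e A j = dimX e B j :=
  dimFD_congr (e.functor.mapIso i) j

theorem dimX_inverse (M : FDMod k (LinearQuiver m)) (j : ℕ) :
    dimX e (e.inverse.obj M) j = dimFD M j :=
  dimFD_congr (e.counitIso.app M) j

theorem dimX_restrX (f : catalan (m + 1)) (A : X) (j : ℕ) :
    dimX e ((restrX e f).obj A) j = dimX e A (sharp f j) :=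
  (dimX_inverse e _ j).trans (dimFD_catRestr f _ j)

theorem dimX_exact {S : ShortComplex X} (hS : S.ShortExact) (j : ℕ) :
    dimX e S.X₂ j = dimX e S.X₁ j + dimX e S.X₃ j := by
  have := hS.mono_f
  have := hS.epi_g
  exact dimFD_add (e.functor.map S.f) (e.functor.map S.g)
    (by rw [← Functor.map_comp, S.zero, Functor.map_zero])
    (KernelFork.mapIsLimit _ hS.fIsKernel e.functor) j

/-- The dimension at a vertex as a function on the Grothendieck group. -/
def dimHom (j : ℕ) : GrAb X →+ ℤ :=
  QuotientAddGroup.lift (exactRel X) (FreeAbelianGroup.lift (Quotient.lift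
    (fun A => (dimX e A j : ℤ)) fun A B ⟨i⟩ => by rw [dimX_congr e i])) (by
    refine (AddSubgroup.closure_le _).2 ?_
    rintro _ ⟨S, hS, rfl⟩
    rw [SetLike.mem_coe, AddMonoidHom.mem_ker, map_sub, map_sub, FreeAbelianGroup.lift_apply_of,
      FreeAbelianGroup.lift_apply_of, FreeAbelianGroup.lift_apply_of]
    change (dimX e S.X₂ j : ℤ) - dimX e S.X₁ j - dimX e S.X₃ j = 0
    rw [dimX_exact e hS]
    push_cast
    ring)

theorem dimHom_mk (j : ℕ) (A : X) : dimHom e j (GrAb.mk A) = dimX e A j :=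
  FreeAbelianGroup.lift_apply_of _ _

/-- The simple objects. -/
def simpleX (b : Paths (LinearQuiver m)) : X := e.inverse.obj ⟨simpleAt k b, isFD_simpleAt b⟩

theorem dimX_simpleX (b : Paths (LinearQuiver m)) (j : ℕ) :
    dimX e (simpleX e b) j = if j = vnum b then 1 else 0 :=
  (dimX_inverse e _ j).trans (dimFD_simple _ j)

theorem isZero_of_dimX {A : X} (h : ∀ j < m, dimX e A j = 0) : IsZero A := by
  rw [IsZero.iff_id_eq_zero]
  refine e.functor.map_injective ?_
  rw [CategoryTheory.Functor.map_id, Functor.map_zero]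
  refine ObjectProperty.hom_ext _ (NatTrans.ext (funext fun b => ModuleCat.hom_ext
    (LinearMap.ext fun y => ?_)))
  have h1 := h _ (vnum_lt b)
  rw [dimX, dimFD_eq _ (vnum_lt b)] at h1
  have := finite_FD (e.functor.obj A) (vtx _ (vnum_lt b))
  exact finrank_zero_iff_forall_zero.1 h1 y

/-- At the largest vertex of the support every element is killed by the nontrivial paths, so a
nonzero one spans a copy of the simple module. -/
theorem exists_simple_mono {A : X} (h : ∃ j < m, dimX e A j ≠ 0) :
    ∃ (b : Paths (LinearQuiver m)) (i : simpleX e b ⟶ A), Mono i := by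
  have hne : ((Finset.range m).filter fun j => dimX e A j ≠ 0).Nonempty := by
    obtain ⟨j, hj, h⟩ := h
    exact ⟨j, by simp [hj, h]⟩
  obtain ⟨j, hj, hmax⟩ := Finset.exists_max_image _ id hne
  rw [Finset.mem_filter, Finset.mem_range] at hj
  have hd := hj.2
  rw [dimX, dimFD_eq _ hj.1] at hd
  have := Module.nontrivial_of_finrank_pos (Nat.pos_of_ne_zero hd)
  obtain ⟨x, hx0⟩ := exists_ne (0 : (e.functor.obj A).obj.obj (vtx j hj.1))
  have hx : ∀ (b : Paths (LinearQuiver m)) (p : vtx j hj.1 ⟶ b), vtx j hj.1 ≠ b →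
      ((e.functor.obj A).obj.map p).hom x = 0 := by
    intro b p hb
    have h1 : dimX e A (vnum b) = 0 := by
      by_contra h0
      have h2 : vnum b ≤ j := hmax (vnum b) (by simp [vnum_lt b, h0])
      exact hb (vnum_injective (le_antisymm (vnum_le p) h2))
    rw [dimX, dimFD_eq _ (vnum_lt b)] at h1
    have := finite_FD (e.functor.obj A) (vtx _ (vnum_lt b))
    exact finrank_zero_iff_forall_zero.1 h1 _
  let ι : (⟨simpleAt k (vtx j hj.1), isFD_simpleAt _⟩ : FDMod k (LinearQuiver m)) ⟶
      e.functor.obj A := ObjectProperty.homMk (simpleHom _ x hx)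
  have hι : Mono ι := by
    refine mono_of_app_injective ι fun b => (injective_iff_map_eq_zero _).2 fun φ hφ => ?_
    refine simpleAt_ext fun hb => ?_
    subst hb
    have h3 := (simpleHom_apply_self _ x hx φ).symm.trans hφ
    rw [map_zero]
    exact (smul_eq_zero.1 h3).resolve_right hx0
  exact ⟨vtx j hj.1, e.inverse.map ι ≫ e.unitInv.app A, @mono_comp _ _ _ _ _ _ (e.inverse.map_mono ι) _ _⟩

theorem mk_eq_sum_simpleX (A : X) :
    GrAb.mk A = ∑ b : Fin m, (dimX e A b : ℤ) • GrAb.mk (simpleX e (fvtx b)) := by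
  -- Induction on the total dimension: split off a simple subobject and pass to its cokernel.
  have key : ∀ (N : ℕ) (A : X), ∑ b : Fin m, dimX e A b ≤ N →
      GrAb.mk A = ∑ b : Fin m, (dimX e A b : ℤ) • GrAb.mk (simpleX e (fvtx b)) := by
    intro N
    induction N with
    | zero =>
      intro A hA
      have h0 : ∀ b : Fin m, dimX e A b = 0 := fun b =>
        Finset.sum_eq_zero_iff.1 (Nat.le_zero.1 hA) b (Finset.mem_univ b)
      rw [GrAb.mk_eq_zero (isZero_of_dimX e fun j hj => h0 ⟨j, hj⟩)]
      simp [h0]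
    | succ N ih =>
      intro A hA
      by_cases h : ∃ j < m, dimX e A j ≠ 0
      · obtain ⟨b, i, hi⟩ := exists_simple_mono e h
        have hS : (ShortComplex.mk i (cokernel.π i) (cokernel.condition i)).ShortExact :=
          { exact := ShortComplex.exact_cokernel i }
        have h1 : GrAb.mk A = GrAb.mk (simpleX e b) + GrAb.mk (cokernel i) := GrAb.mk_exact hS
        have h2 : ∀ j, dimX e A j = dimX e (simpleX e b) j + dimX e (cokernel i) j :=
          dimX_exact e hS
        have h3 : ∑ b' : Fin m, dimX e (simpleX e b) b' = 1 := by
          rw [Finset.sum_eq_single (⟨vnum b, vnum_lt b⟩ : Fin m)]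
          · rw [dimX_simpleX, if_pos rfl]
          · intro b' _ hb'
            rw [dimX_simpleX, if_neg fun h => hb' (Fin.ext h)]
          · exact fun h => absurd (Finset.mem_univ _) h
        have h4 : ∑ b' : Fin m, (dimX e (simpleX e b) b' : ℤ) • GrAb.mk (simpleX e (fvtx b')) =
            GrAb.mk (simpleX e b) := by
          rw [Finset.sum_eq_single (⟨vnum b, vnum_lt b⟩ : Fin m)]
          · rw [dimX_simpleX, if_pos rfl, Nat.cast_one, one_smul]
            rfl
          · intro b' _ hb'
            rw [dimX_simpleX, if_neg fun h => hb' (Fin.ext h), Nat.cast_zero, zero_smul]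
          · exact fun h => absurd (Finset.mem_univ _) h
        have h5 : ∑ b' : Fin m, dimX e (cokernel i) b' ≤ N := by
          simp only [h2, Finset.sum_add_distrib, h3] at hA
          omega
        rw [h1, ih _ h5, ← h4, ← Finset.sum_add_distrib]
        refine Finset.sum_congr rfl fun b' _ => ?_
        rw [← add_smul, h2, Nat.cast_add]
      · push Not at h
        refine ih A ?_
        rw [Finset.sum_eq_zero fun (b : Fin m) _ => h b.val b.isLt]
        exact Nat.zero_le _
  exact key _ A le_rfl

theorem eq_sum_simpleX (x : GrAb X) :
    x = ∑ b : Fin m, dimHom e b x • GrAb.mk (simpleX e (fvtx b)) := by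
  obtain ⟨x, rfl⟩ := QuotientAddGroup.mk_surjective x
  induction x using FreeAbelianGroup.induction_on with
  | zero => simp
  | neg x h =>
    rw [QuotientAddGroup.mk_neg]
    simp only [map_neg, neg_smul, Finset.sum_neg_distrib]
    exact congrArg Neg.neg h
  | add x y hx hy =>
    rw [QuotientAddGroup.mk_add]
    simp only [map_add, add_smul, Finset.sum_add_distrib]
    rw [← hx, ← hy]
  | of x =>
    induction x using Quotient.inductionOn with
    | _ A =>
      change GrAb.mk A = ∑ b : Fin m, dimHom e b (GrAb.mk A) • _
      simp only [dimHom_mk]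
      exact mk_eq_sum_simpleX e A

theorem dimHom_of_le (j : ℕ) (h : m ≤ j) (x : GrAb X) : dimHom e j x = 0 := by
  rw [eq_sum_simpleX e x, map_sum]
  refine Finset.sum_eq_zero fun b _ => ?_
  rw [map_zsmul, dimHom_mk, dimX, dimFD_eq_zero _ h, Nat.cast_zero, smul_zero]

/-! ### The basis of injectives -/

/-- The multiplicities of the indecomposable injectives, as a function on the Grothendieck
group. -/
def injCoord : GrAb X →ₗ[ℤ] (Fin m → ℤ) :=
  LinearMap.pi fun r => (dimHom e r.val - dimHom e (r.val + 1)).toIntLinearMap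

theorem injCoord_apply (x : GrAb X) (r : Fin m) :
    injCoord e x r = dimHom e r x - dimHom e (r + 1) x := rfl

theorem injCoord_injective : Function.Injective (injCoord e) := by
  refine (injective_iff_map_eq_zero _).2 fun x hx => ?_
  -- Downward induction from j = m, where the dimension vanishes: if all drops are zero, all
  -- dimensions are zero.
  have h : ∀ d j, j + d = m → dimHom e j x = 0 := by
    intro d
    induction d with
    | zero => exact fun j hj => dimHom_of_le e j (by omega) x
    | succ d ih =>
      intro j hj
      have h1 := injCoord_apply e x ⟨j, by omega⟩
      rw [hx] at h1
      change 0 = dimHom e j x - dimHom e (j + 1) x at h1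
      rw [ih (j + 1) (by omega), sub_zero] at h1
      exact h1.symm
  rw [eq_sum_simpleX e x]
  refine Finset.sum_eq_zero fun b _ => ?_
  rw [h (m - b) b (by omega), zero_smul]

/-- The classes of the indecomposable injective objects. -/
def injCls (c : Fin m) : GrAb X := GrAb.mk (e.inverse.obj (inj k (V := LinearQuiver m) c))

/-- The dimension vector of I_c is 1 up to c and 0 afterwards, so its only drop is at c. -/
theorem injCoord_injCls (c : Fin m) : injCoord e (injCls e c) = Pi.single c 1 := by
  ext r
  rw [injCoord_apply, injCls, dimHom_mk, dimHom_mk, dimX_inverse, dimX_inverse, dimFD_inj,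
    dimFD_inj, Pi.single_apply]
  rcases lt_trichotomy r c with h | rfl | h
  · have := Fin.lt_def.1 h
    rw [if_pos (by omega), if_pos (by omega), if_neg h.ne]
    simp
  · simp
  · have := Fin.lt_def.1 h
    rw [if_neg (by omega), if_neg (by omega), if_neg h.ne']
    simp

theorem injCoord_surjective : Function.Surjective (injCoord e) := by
  intro v
  refine ⟨∑ c, v c • injCls e c, ?_⟩
  simp only [map_sum, map_smul, injCoord_injCls]
  exact (pi_eq_sum_univ' v).symm

/-- The basis of the Grothendieck group consisting of the classes of the injectives. -/
def injBasis : Module.Basis (Fin m) ℤ (GrAb X) :=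
  Module.Basis.ofEquivFun (LinearEquiv.ofBijective (injCoord e)
    ⟨injCoord_injective e, injCoord_surjective e⟩)

theorem injBasis_repr (x : GrAb X) (r : Fin m) : (injBasis e).repr x r = injCoord e x r := rfl

theorem injBasis_apply (c : Fin m) : injBasis e c = injCls e c := by
  apply injCoord_injective e
  rw [injCoord_injCls]
  ext r
  rw [← injBasis_repr, Module.Basis.repr_self, Finsupp.single_apply, Pi.single_apply]
  simp only [eq_comm]

theorem sum_Ico_sub_succ (a : ℕ → ℤ) {p q : ℕ} (h : p ≤ q) :
    ∑ c ∈ Finset.Ico p q, (a c - a (c + 1)) = a p - a q := by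
  induction q, h using Nat.le_induction with
  | base => simp
  | succ q hpq ih =>
    rw [Finset.sum_Ico_succ_top hpq, ih]
    ring

/-- By adjunction f(c+1) = r+1 means f♯(r) ≤ c < f♯(r+1), so row r sums the drops of a over an
interval and telescopes. -/
theorem naturalRep_mulVec (f : catalan (m + 1)) (a : ℕ → ℤ) (r : Fin m) :
    (naturalRep m f).mulVec (fun c : Fin m => a c - a (c + 1)) r =
      a (sharp f r) - a (sharp f (r + 1)) := by
  rw [← sum_Ico_sub_succ a ((sharp f).monotone (Nat.le_add_right r.val 1)), Matrix.mulVec, dotProduct]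
  have h1 : ∀ c : Fin m, naturalRep m f r c * (a c - a (c + 1)) =
      if c.val ∈ Finset.Ico (sharp f r) (sharp f (r + 1)) then a c - a (c + 1) else 0 := by
    intro c
    have h2 := le_sharp_iff f c.succ r
    have h3 := le_sharp_iff f c.succ (r + 1)
    have h4 : f.1 c.succ = r.succ ↔ c.val ∈ Finset.Ico (sharp f r) (sharp f (r + 1)) := by
      rw [Finset.mem_Ico, Fin.ext_iff]
      simp only [Fin.val_succ] at h2 h3 ⊢
      omega
    change (if f.1 c.succ = r.succ then (1 : ℤ) else 0) * _ = _
    simp only [h4]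
    split_ifs <;> simp
  rw [Finset.sum_congr rfl fun c _ => h1 c, Fin.sum_univ_eq_sum_range (fun c =>
    if c ∈ Finset.Ico (sharp f r) (sharp f (r + 1)) then a c - a (c + 1) else 0) m,
    ← Finset.sum_filter]
  refine Finset.sum_congr ?_ fun _ _ => rfl
  ext c
  have := sharp_le f (r + 1)
  simp only [Finset.mem_filter, Finset.mem_range, Finset.mem_Ico]
  omega

theorem naturalRep_catalanZero : naturalRep m (catalanZero m) = 0 := by
  ext r c
  change (if (0 : Fin (m + 1)) = r.succ then (1 : ℤ) else 0) = 0
  exact if_neg (Fin.succ_ne_zero r).symm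

/-! ### The action on the Grothendieck group -/

/-- The action of the Grothendieck ring on the Grothendieck group. -/
def grAction : GrG e →+* Module.End ℤ (GrAb X) :=
  ((Matrix.toLinAlgEquiv (injBasis e) : Matrix (Fin m) (Fin m) ℤ ≃ₐ[ℤ] _) :
    Matrix (Fin m) (Fin m) ℤ →+* Module.End ℤ (GrAb X)).comp
    ((contractedLift ((naturalRep m : _ →* Matrix (Fin m) (Fin m) ℤ)) naturalRep_catalanZero).comp
      ((grEquiv e).symm : GrG e →+* ContractedRing m))

theorem toMatrix_grAction (f : catalan (m + 1)) :
    LinearMap.toMatrix (injBasis e) (injBasis e) (grAction e (GrG.mk (restrG e f))) =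
      naturalRep m f := by
  have h : grAction e (GrG.mk (restrG e f)) =
      Matrix.toLin (injBasis e) (injBasis e) (naturalRep m f) := by
    change Matrix.toLinAlgEquiv (injBasis e) (contractedLift _ naturalRep_catalanZero
      ((grEquiv e).symm (GrG.mk (restrG e f)))) = _
    rw [grEquiv_symm_mk, contractedLift_mk]
    rfl
  rw [h, LinearMap.toMatrix_toLin]

theorem GrAb.mk_biprod_app (F F' : GCat e) (A : X) :
    GrAb.mk ((F ⊞ F').obj.obj A) = GrAb.mk (F.obj.obj A) + GrAb.mk (F'.obj.obj A) := by
  have h {H H' : GCat e} {t t' : H ⟶ H'} (h : t = t') : t.hom.app A = t'.hom.app A := by rw [h]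
  let S : ShortComplex X := ShortComplex.mk ((biprod.inl : F ⟶ F ⊞ F').hom.app A)
    ((biprod.snd : F ⊞ F' ⟶ F').hom.app A) (h biprod.inl_snd)
  have hS : S.ShortExact := ShortComplex.Splitting.shortExact
    { r := (biprod.fst : F ⊞ F' ⟶ F).hom.app A
      s := (biprod.inr : F' ⟶ F ⊞ F').hom.app A
      f_r := h biprod.inl_fst
      s_g := h biprod.inr_snd
      id := h biprod.total }
  exact GrAb.mk_exact hS

/-- The action was built from matrices, which makes it a ring homomorphism; here it is matched with
the functors. Direct sums give split exact sequences at A, and for R_f both sides have the same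
drops of dimension. -/
theorem grAction_mk (F : GCat e) (A : X) :
    grAction e (GrG.mk F) (GrAb.mk A) = GrAb.mk (F.obj.obj A) := by
  induction F using gcat_induction e with
  | hiso i h =>
    rw [← GrG.mk_congr i, h]
    exact GrAb.mk_congr (((IsOneMor e).ι.mapIso i).app A)
  | hsum F F' h h' =>
    rw [GrG.mk_biprod, map_add, LinearMap.add_apply, h, h', GrAb.mk_biprod_app]
  | hrestr f =>
    apply injCoord_injective e
    ext r
    have h1 := LinearMap.toMatrix_mulVec_repr (injBasis e) (injBasis e)
      (grAction e (GrG.mk (restrG e f))) (GrAb.mk A)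
    rw [toMatrix_grAction] at h1
    have h2 := naturalRep_mulVec f (fun j => (dimX e A j : ℤ)) r
    have h3 : ((injBasis e).repr (GrAb.mk A) : Fin m → ℤ) =
        fun c : Fin m => (dimX e A c : ℤ) - dimX e A (c + 1) := by
      ext c
      rw [injBasis_repr, injCoord_apply, dimHom_mk, dimHom_mk]
    rw [← injBasis_repr, ← h1, h3, h2, injCoord_apply, dimHom_mk, dimHom_mk]
    change _ = (dimX e ((restrX e f).obj A) r : ℤ) - dimX e ((restrX e f).obj A) (r + 1)
    rw [dimX_restrX, dimX_restrX]

/-- The isomorphism of the Catalan monoid with the monoid of classes of indecomposable or zero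
1-morphisms. -/
def catalanEquiv : catalan (m + 1) ≃* MonoidHom.mrange (restrCls e) :=
  MulEquiv.ofBijective (restrCls e).mrangeRestrict
    ⟨fun _ _ h => restrCls_injective e (congrArg Subtype.val h),
      (restrCls e).mrangeRestrict_surjective⟩

end GrothendieckGroup
end CatalanCat
end

theorem theorem1 (k : Type u) [Field k] [IsAlgClosed k] (m : ℕ)
    (X : Type v) [Category.{w} X] [Abelian X] (e : X ≌ CatalanCat.FDMod k (CatalanCat.LinearQuiver m)) :
    ∃ (S : Submonoid (CatalanCat.IsoCl (CatalanCat.GCat e)))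
      (Φ : CatalanCat.catalan (m + 1) ≃* S)
      (Ψ : CatalanCat.GrG e ≃+* CatalanCat.ContractedRing m)
      (ρ : CatalanCat.GrG e →+* Module.End ℤ (CatalanCat.GrAb X))
      (b : Module.Basis (Fin m) ℤ (CatalanCat.GrAb X)),
      -- the classes of indecomposable or zero 1-morphisms are closed under composition
      (S : Set (CatalanCat.IsoCl (CatalanCat.GCat e))) = CatalanCat.indecClasses e ∧
      -- the isomorphism with the Catalan monoid
      (∀ i : Fin m, (Φ (CatalanCat.alpha i) : CatalanCat.IsoCl (CatalanCat.GCat e)) =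
        CatalanCat.cls (CatalanCat.GCat.gen e i)) ∧
      (∀ (f : CatalanCat.catalan (m + 1)) (F : CatalanCat.GCat e),
        (Φ f : CatalanCat.IsoCl (CatalanCat.GCat e)) = CatalanCat.cls F →
          -- the zero 1-morphism corresponds to the zero element
          (IsZero F ↔ f = CatalanCat.catalanZero m) ∧
          -- the isomorphism of the Grothendieck ring with the contracted monoid ring
          Ψ (CatalanCat.GrG.mk F) = CatalanCat.ContractedRing.mk f ∧
          -- the action on the Grothendieck group is the natural representation
          LinearMap.toMatrix b b (ρ (CatalanCat.GrG.mk F)) = CatalanCat.naturalRep m f) ∧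
      -- the action is induced by the functorial action on `X`
      (∀ (F : CatalanCat.GCat e) (A : X),
        ρ (CatalanCat.GrG.mk F) (CatalanCat.GrAb.mk A) = CatalanCat.GrAb.mk (F.obj.obj A)) ∧
      -- the basis consists of the classes of the indecomposable injective modules
      (∀ i : Fin m, b i = CatalanCat.GrAb.mk
        (e.inverse.obj (CatalanCat.inj k (V := CatalanCat.LinearQuiver m) i))) := by
  open CatalanCat in
  refine ⟨MonoidHom.mrange (restrCls e), catalanEquiv e, (grEquiv e).symm, grAction e, injBasis e,
    range_restrCls e, fun i => ?_, fun f F hF => ?_, grAction_mk e, injBasis_apply e⟩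
  · exact cls_eq ((IsOneMor e).isoMk (genXIso e i).symm)
  -- All three claims are invariant under isomorphism, so they need checking only for R_f.
  · obtain ⟨i⟩ : Nonempty (restrG e f ≅ F) := Quotient.exact hF
    rw [← GrG.mk_congr i]
    exact ⟨i.symm.isZero_iff.trans (isZero_restrG_iff e f), grEquiv_symm_mk e f,
      toMatrix_grAction e f⟩
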